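/- Let $n\ge 2$ be an integer and $k\in\mathbb R$. Put $\bar r_k=+\infty$ if $k\le 0$ and $\bar r_k=\pi/\sqrt k$ if $k>0$; let $s_k(r)$ be $\sinh(\sqrt{-k}\,r)/\sqrt{-k}$, $r$, $\sin(\sqrt k\,r)/\sqrt k$ for $k<0$, $k=0$, $k>0$ respectively, and $\cot_k=s_k'/s_k$. Let $f\in C^1(\mathbb R)$ satisfy the Standard Conditions: there is an interval $I_f\subset[0,\infty)$ with $0\in\partial I_f$ such that $f(x)>0$ and $f(x)\ge nkx+f(0)$ for all $x\in I_f$, and $f(0)>0$ if $k\le0$. Suppose there is $\bar M>0$ with $(0,\bar M)\subset I_f$ and $f(x)\ge x f'(x)$ for all $0<x<\bar M$. Fix $M\in(0,\bar M)$. For $R\in[0,\bar r_k)$ let $U_{R}=U_{R,M,k,f}$ be the maximal solution, on an interval relatively open in $[0,\bar r_k)$ and containing $R$, of $$U''(r)+(n-1)\cot_k(r)\,U'(r)+f(U(r))=0\ \ (r>0),\qquad U(R)=M,\quad U'(R)=0,$$ let $r_+(R)$ be its first zero to the right of $R$, let $r_-(R)$ be its last zero to the left of $R$ if $R>0$, and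 put $r_-(0)=0$. Define $$\overline\tau^{\pm}_{M,k,f}(R)=\frac{U_R'(r_\pm(R))^2}{U_0'(r_+(0))^2},\qquad \tau^0_{k,f}(M)=\inf_{R\in[0,\bar r_k)}\overline\tau^+_{M,k,f}(R).$$ Then these objects are well defined: for every $R\in[0,\bar r_k)$ the maximal solution $U_R$ exists and is defined on $[r_-(R),r_+(R)]$, $R<r_+(R)$, $0<r_-(R)<R$ if $R>0$, $U_R(R)>0$, $U_R>0$ on $(r_-(R),r_+(R))$, $U_R'\ne0$ on $(r_-(R),r_+(R))\setminus\{R\}$, $U_R(r_+(R))=0$, and $U_R(r_-(R))=0$ if $R>0$. Moreover, $$\tau^0_{k,f}(M)=\overline\tau^+_{M,k,f}(0)=1,$$ $\overline\tau^-_{M,k,f}$ is strictly decreasing on $(0,\bar r_k)$, and $\overline\tau^+_{M,k,f}$ is strictly increasing on $(0,\bar r_k)$. -/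

import Mathlib

open Set

noncomputable section

namespace RadialModel

/-- The right end `r̄_k` of the radial interval: `+∞` if `k ≤ 0` and `π / √k` if `k > 0`. -/
def rBar (k : ℝ) : EReal :=
  if k ≤ 0 then ⊤ else ((Real.pi / Real.sqrt k : ℝ) : EReal)

/-- The interval `[0, r̄_k)`. -/
def baseInterval (k : ℝ) : Set ℝ := {r | 0 ≤ r ∧ (r : EReal) < rBar k}

/-- The open interval `(0, r̄_k)`. -/
def openBaseInterval (k : ℝ) : Set ℝ := {r | 0 < r ∧ (r : EReal) < rBar k}

/-- The warping function `s_k`. -/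
def sk (k r : ℝ) : ℝ :=
  if k < 0 then Real.sinh (Real.sqrt (-k) * r) / Real.sqrt (-k)
  else if k = 0 then r
  else Real.sin (Real.sqrt k * r) / Real.sqrt k

/-- `cot_k = s_k' / s_k`. -/
def cotk (k r : ℝ) : ℝ := deriv (sk k) r / sk k r

/-- `f` satisfies the Standard Conditions (in dimension `n`, with curvature parameter `k`)
on the interval `I`. -/
structure StandardConditions (n : ℕ) (k : ℝ) (f : ℝ → ℝ) (I : Set ℝ) : Prop where
  nonempty : I.Nonempty
  ordConnected : I.OrdConnected
  subset_nonneg : I ⊆ Ici 0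
  zero_mem_frontier : (0 : ℝ) ∈ frontier I
  pos : ∀ x ∈ I, 0 < f x
  lower_bound : ∀ x ∈ I, (n : ℝ) * k * x + f 0 ≤ f x
  zero_pos : k ≤ 0 → 0 < f 0

/-- `U` is, on the interval `J` (relatively open in `[0, r̄_k)` and containing `R`), a solution of
`U'' + (n - 1) cot_k U' + f(U) = 0` with `U(R) = M` and `U'(R) = 0`. The equation is required at
the points `r > 0` of `J`; at `r = 0` the function is continuous, and if `R = 0` then the
condition `U'(0) = 0` is about the right derivative. -/
structure IsRadialSolution (n : ℕ) (k : ℝ) (f : ℝ → ℝ) (R M : ℝ) (J : Set ℝ) (U : ℝ → ℝ) :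
    Prop where
  relOpen : ∃ O : Set ℝ, IsOpen O ∧ J = O ∩ baseInterval k
  ordConnected : J.OrdConnected
  core_mem : R ∈ J
  continuousOn : ContinuousOn U J
  differentiableAt : ∀ r ∈ J, 0 < r → DifferentiableAt ℝ U r
  ode : ∀ r ∈ J, 0 < r →
    HasDerivAt (deriv U) (-(((n : ℝ) - 1) * cotk k r * deriv U r) - f (U r)) r
  value_core : U R = M
  deriv_core : HasDerivWithinAt U 0 J R

/-- The domain of the maximal solution `U_{R,M,k,f}`: the union of the intervals on which
the Cauchy problem has a solution. -/
def radialDomain (n : ℕ) (k : ℝ) (f : ℝ → ℝ) (R M : ℝ) : Set ℝ :=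
  {r | ∃ (J : Set ℝ) (U : ℝ → ℝ), IsRadialSolution n k f R M J U ∧ r ∈ J}

open Classical in
/-- The maximal solution `U_{R,M,k,f}`: its value at a point of `radialDomain` is the common value
there of the solutions of the Cauchy problem (it is set to `0` off `radialDomain`). -/
def radialSolution (n : ℕ) (k : ℝ) (f : ℝ → ℝ) (R M : ℝ) (r : ℝ) : ℝ :=
  if h : ∃ v : ℝ, ∃ (J : Set ℝ) (U : ℝ → ℝ),
      IsRadialSolution n k f R M J U ∧ r ∈ J ∧ U r = v then
    Classical.choose h
  else 0

/-- `r_+(R,M,k,f)`: the first zero of `U_{R,M,k,f}` to the right of `R`. -/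
def rPlus (n : ℕ) (k : ℝ) (f : ℝ → ℝ) (R M : ℝ) : ℝ :=
  sInf {r | r ∈ radialDomain n k f R M ∧ R < r ∧ radialSolution n k f R M r = 0}

open Classical in
/-- `r_-(R,M,k,f)`: the last zero of `U_{R,M,k,f}` to the left of `R` if `R > 0`,
and `0` if `R = 0`. -/
def rMinus (n : ℕ) (k : ℝ) (f : ℝ → ℝ) (R M : ℝ) : ℝ :=
  if R = 0 then 0
  else sSup {r | r ∈ radialDomain n k f R M ∧ r < R ∧ radialSolution n k f R M r = 0}

/-- The property that `k`-admissibility asks of the pair `(R, M)`: the maximal solution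
`U_{R,M,k,f}` exists, is defined on `[r_-, r_+]`, is positive inside, vanishes at the boundary
radii (only at `r_+` if `R = 0`) and is critical inside only at `R`. -/
structure IsAdmissiblePair (n : ℕ) (k : ℝ) (f : ℝ → ℝ) (R M : ℝ) : Prop where
  isSolution :
    IsRadialSolution n k f R M (radialDomain n k f R M) (radialSolution n k f R M)
  subset_domain : Icc (rMinus n k f R M) (rPlus n k f R M) ⊆ radialDomain n k f R M
  core_lt : R < rPlus n k f R M
  rMinus_pos : 0 < R → 0 < rMinus n k f R M ∧ rMinus n k f R M < R
  value_core_pos : 0 < radialSolution n k f R M R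
  pos : ∀ r ∈ Ioo (rMinus n k f R M) (rPlus n k f R M), 0 < radialSolution n k f R M r
  deriv_ne : ∀ r ∈ Ioo (rMinus n k f R M) (rPlus n k f R M), r ≠ R →
    deriv (radialSolution n k f R M) r ≠ 0
  zero_plus : radialSolution n k f R M (rPlus n k f R M) = 0
  zero_minus : 0 < R → radialSolution n k f R M (rMinus n k f R M) = 0

/-- The model function `τ̄⁺_{M,k,f}`. -/
def tauPlus (n : ℕ) (k : ℝ) (f : ℝ → ℝ) (M R : ℝ) : ℝ :=
  deriv (radialSolution n k f R M) (rPlus n k f R M) ^ 2 /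
    deriv (radialSolution n k f 0 M) (rPlus n k f 0 M) ^ 2

/-- The model function `τ̄⁻_{M,k,f}`. -/
def tauMinus (n : ℕ) (k : ℝ) (f : ℝ → ℝ) (M R : ℝ) : ℝ :=
  deriv (radialSolution n k f R M) (rMinus n k f R M) ^ 2 /
    deriv (radialSolution n k f 0 M) (rPlus n k f 0 M) ^ 2

/-- `τ⁰_{k,f}(M)`: the infimum of `τ̄⁺_{M,k,f}` over `[0, r̄_k)`. -/
def tauZero (n : ℕ) (k : ℝ) (f : ℝ → ℝ) (M : ℝ) : ℝ :=
  sInf (tauPlus n k f M '' baseInterval k)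

end RadialModel

end

/-! Write the equation as `U' = V`, `V' = -h V - f(U)` with `h = (n - 1) cot_k`, the logarithmic
derivative of the weight `w = s_k ^ (n - 1)`. The only geometric input to the comparison is that `h`
is strictly decreasing. Under the reflection `r ↦ -r` the part of the solution to the left of `R`
becomes a solution to the right of `-R`, with `h` replaced by `-h(-r)`, which is again strictly
decreasing. Hence one theory of solutions on a half-interval serves both sides: `tauPlus` compares
cores `R₁ < R₂`, and `tauMinus` compares the reflected cores `-R₂ < -R₁`.

A branch descends to zero because `(w V)' = -w f(U) < 0` while `U > 0`. If the interval ends at a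
zero of the weight, `V` is at most a negative multiple of the reciprocal distance to that end, so
`U` would tend to `-∞` logarithmically. If the interval is infinite (`k ≤ 0`), `f` has a positive
lower bound on `(0, M]` and `V` stays below a negative constant (`exists_rightBranch`).

The comparison (`RightBranch.slope_lt_of_lt`) has two stages. Since `f(x)/x` is nonincreasing, a
Sturm argument with the weighted Wronskian shows that the branch with the larger core lies strictly
above the other (`RightBranch.lt_of_lt`). Therefore the inverse functions satisfy `ρ₁(u) < ρ₂(u)`.
As a function of the height `u`, the slope obeys `dV/du = -h(ρ(u)) - f(u)/V`. Both slopes vanish at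
`u = M`, and `h(ρ₂) < h(ρ₁)` forces `V₂ < V₁ < 0` at `u = 0`.

The core `0` is allowed in this comparison on the right, so `tauPlus` is strictly increasing on all
of `[0, r̄_k)` and its infimum is its value at `0`. What remains is to identify the branches with
the maximal solution: gluing at `R`, and uniqueness in spite of the singularity of `h` at `0`. -/

namespace RadialModel

open Filter Topology

/-! ### The initial value problem on a half-interval: uniqueness and existence. -/

/-- `S` is an open interval whose left end is `R`. -/
structure HalfDomain (R : ℝ) (S : Set ℝ) : Prop where
  isOpen : IsOpen S
  lt : ∀ r ∈ S, R < r
  Ioc_subset : ∀ r ∈ S, Ioc R r ⊆ S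

/-- `w` is a positive weight on `S` with decreasing logarithmic derivative `h`, continuous from the
right at the left end `R` of `S`. -/
structure HalfWeight (w h : ℝ → ℝ) (R : ℝ) (S : Set ℝ) : Prop where
  cont : ContinuousWithinAt w (Ici R) R
  pos : ∀ r ∈ S, 0 < w r
  deriv : ∀ r ∈ S, HasDerivAt w (h r * w r) r
  anti : StrictAntiOn h S

/-- `(U, V)` solves `U' = V`, `V' = - h V - F(U)` on `S`, with `U(R) = M`, `V(R) = 0`. -/
structure HalfSolution (h F : ℝ → ℝ) (R M : ℝ) (S : Set ℝ) (U V : ℝ → ℝ) : Prop where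
  contU : ContinuousOn U (insert R S)
  contV : ContinuousOn V (insert R S)
  value : U R = M
  slope : V R = 0
  derivU : ∀ r ∈ S, HasDerivAt U (V r) r
  derivV : ∀ r ∈ S, HasDerivAt V (-(h r * V r) - F (U r)) r

/-- Lipschitz continuity on bounded sets. -/
def BoundedLipschitz (F : ℝ → ℝ) : Prop :=
  ∀ B : ℝ, ∃ L : ℝ, 0 ≤ L ∧ ∀ x y, |x| ≤ B → |y| ≤ B → |F x - F y| ≤ L * |x - y|

theorem boundedLipschitz_of_contDiff {f : ℝ → ℝ} (hf : ContDiff ℝ 1 f) : BoundedLipschitz f := by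
  intro B
  obtain ⟨K, hK⟩ := (hf.locallyLipschitz.locallyLipschitzOn
    (s := Icc (-B) B)).exists_lipschitzOnWith_of_compact isCompact_Icc
  refine ⟨K, K.2, fun x y hx hy => ?_⟩
  simpa [Real.dist_eq] using hK.dist_le_mul x (abs_le.1 hx) y (abs_le.1 hy)

theorem HalfDomain.Icc_subset {R : ℝ} {S : Set ℝ} (hS : HalfDomain R S) {b : ℝ} (hb : b ∈ S) :
    Icc R b ⊆ insert R S := by
  intro r hr
  rcases hr.1.eq_or_lt with h | h
  · exact Or.inl h.symm
  · exact Or.inr (hS.Ioc_subset b hb ⟨h, hr.2⟩)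

theorem HalfDomain.Ioo {R b : ℝ} : HalfDomain R (Ioo R b) :=
  ⟨isOpen_Ioo, fun _ hr => hr.1, fun _ hr _ hx => ⟨hx.1, hx.2.trans_lt hr.2⟩⟩

theorem HalfDomain.Ioi {R : ℝ} : HalfDomain R (Ioi R) :=
  ⟨isOpen_Ioi, fun _ hr => hr, fun _ _ _ hx => hx.1⟩

theorem HalfSolution.mono {h F : ℝ → ℝ} {R M : ℝ} {S T : Set ℝ} {U V : ℝ → ℝ}
    (hU : HalfSolution h F R M S U V) (hT : T ⊆ S) : HalfSolution h F R M T U V :=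
  ⟨hU.contU.mono (insert_subset_insert hT), hU.contV.mono (insert_subset_insert hT), hU.value,
    hU.slope, fun r hr => hU.derivU r (hT hr), fun r hr => hU.derivV r (hT hr)⟩

theorem HalfWeight.continuousOn {w h : ℝ → ℝ} {R : ℝ} {S : Set ℝ} (hS : HalfDomain R S)
    (hw : HalfWeight w h R S) : ContinuousOn w (insert R S) := by
  rintro r (rfl | hr)
  · refine hw.cont.mono ?_
    rintro x (rfl | hx)
    · exact self_mem_Ici
    · exact (hS.lt x hx).le
  · exact (hw.deriv r hr).continuousAt.continuousWithinAt

/-- Gronwall for the squared distance of the two solutions, damped by `exp (-K r)`. Only a lower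
bound for `h` enters, because `-2 h (V₁ - V₂)²` has the good sign where `h` is positive. A
singularity `h → +∞` at `R` is thus harmless, which is what the core `R = 0` requires. -/
theorem HalfSolution.eqOn {h F : ℝ → ℝ} {R M : ℝ} {S : Set ℝ} {U₁ V₁ U₂ V₂ : ℝ → ℝ}
    (hS : HalfDomain R S) (hh : AntitoneOn h S) (hF : BoundedLipschitz F)
    (h₁ : HalfSolution h F R M S U₁ V₁) (h₂ : HalfSolution h F R M S U₂ V₂) :
    ∀ r ∈ insert R S, U₁ r = U₂ r ∧ V₁ r = V₂ r := by
  rintro b (rfl | hb)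
  · exact ⟨by rw [h₁.value, h₂.value], by rw [h₁.slope, h₂.slope]⟩
  have hRb := hS.lt b hb
  have hsub := hS.Icc_subset hb
  obtain ⟨B₁, hB₁⟩ := isCompact_Icc.exists_bound_of_continuousOn (h₁.contU.mono hsub)
  obtain ⟨B₂, hB₂⟩ := isCompact_Icc.exists_bound_of_continuousOn (h₂.contU.mono hsub)
  obtain ⟨L, hL, hFL⟩ := hF (max B₁ B₂)
  -- The three summands absorb the damping term (through `h b ≤ h r`), the Lipschitz term, and the
  -- coupling `2 (U₁ - U₂) (V₁ - V₂)`.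
  set K : ℝ := 2 * |h b| + L + 1 with hK
  let E : ℝ → ℝ := fun r => ((V₁ r - V₂ r) ^ 2 + (U₁ r - U₂ r) ^ 2) * Real.exp (-K * r)
  have hder : ∀ r ∈ Set.Ioo R b, HasDerivAt E
      ((2 * (V₁ r - V₂ r) * ((-(h r * V₁ r) - F (U₁ r)) - (-(h r * V₂ r) - F (U₂ r)))
        + 2 * (U₁ r - U₂ r) * (V₁ r - V₂ r)) * Real.exp (-K * r) +
        ((V₁ r - V₂ r) ^ 2 + (U₁ r - U₂ r) ^ 2) * (Real.exp (-K * r) * -K)) r := by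
    intro r hr
    have hrS : r ∈ S := hS.Ioc_subset b hb ⟨hr.1, hr.2.le⟩
    have e1 := ((h₁.derivV r hrS).sub (h₂.derivV r hrS)).pow 2
    have e2 := ((h₁.derivU r hrS).sub (h₂.derivU r hrS)).pow 2
    have e3 : HasDerivAt (fun r => Real.exp (-K * r)) (Real.exp (-K * r) * -K) r := by
      simpa using ((hasDerivAt_id r).const_mul (-K)).exp
    refine ((e1.add e2).mul e3).congr_deriv ?_
    simp
  have hanti : AntitoneOn E (Icc R b) := by
    refine antitoneOn_of_deriv_nonpos (convex_Icc R b) ?_ ?_ ?_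
    · refine ContinuousOn.mul (ContinuousOn.add ?_ ?_) (by fun_prop)
      · exact ((h₁.contV.mono hsub).sub (h₂.contV.mono hsub)).pow 2
      · exact ((h₁.contU.mono hsub).sub (h₂.contU.mono hsub)).pow 2
    · rw [interior_Icc]
      exact fun r hr => (hder r hr).differentiableAt.differentiableWithinAt
    · rw [interior_Icc]
      intro r hr
      rw [(hder r hr).deriv]
      have hrS : r ∈ S := hS.Ioc_subset b hb ⟨hr.1, hr.2.le⟩
      have hhb : h b ≤ h r := hh hrS hb hr.2.le
      have hl : |F (U₁ r) - F (U₂ r)| ≤ L * |U₁ r - U₂ r| :=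
        hFL _ _ ((hB₁ r ⟨hr.1.le, hr.2.le⟩).trans (le_max_left _ _))
          ((hB₂ r ⟨hr.1.le, hr.2.le⟩).trans (le_max_right _ _))
      set v := V₁ r - V₂ r with hv
      set u := U₁ r - U₂ r with hu
      set d := F (U₁ r) - F (U₂ r) with hd
      have key : 2 * v * (-(h r) * v - d) + 2 * u * v ≤ K * (v ^ 2 + u ^ 2) := by
        have a1 : -(h r) * v ^ 2 ≤ |h b| * v ^ 2 :=
          mul_le_mul_of_nonneg_right (by linarith [neg_abs_le (h b)]) (sq_nonneg v)
        have a2 : -(v * d) ≤ |v| * (L * |u|) := by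
          calc -(v * d) ≤ |v * d| := neg_le_abs _
            _ = |v| * |d| := abs_mul _ _
            _ ≤ _ := mul_le_mul_of_nonneg_left hl (abs_nonneg v)
        have a3 : u * v ≤ |v| * |u| := by
          rw [← abs_mul, mul_comm v]; exact le_abs_self _
        have a4 : 2 * (|v| * |u|) ≤ v ^ 2 + u ^ 2 := by
          nlinarith [sq_nonneg (|v| - |u|), sq_abs v, sq_abs u]
        have a5 : 0 ≤ |h b| * u ^ 2 := by positivity
        nlinarith [mul_le_mul_of_nonneg_left a4 hL]
      have : (2 * v * ((-(h r * V₁ r) - F (U₁ r)) - (-(h r * V₂ r) - F (U₂ r))) + 2 * u * v) *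
          Real.exp (-K * r) + (v ^ 2 + u ^ 2) * (Real.exp (-K * r) * -K)
          = (2 * v * (-(h r) * v - d) + 2 * u * v - K * (v ^ 2 + u ^ 2)) * Real.exp (-K * r) := by
        rw [hv, hd]; ring
      rw [this]
      exact mul_nonpos_of_nonpos_of_nonneg (by linarith) (Real.exp_pos _).le
  have hle := hanti (left_mem_Icc.2 hRb.le) (right_mem_Icc.2 hRb.le) hRb.le
  have hzero : E R = 0 := by simp [E, h₁.value, h₂.value, h₁.slope, h₂.slope]
  rw [hzero] at hle
  have hle' : (V₁ b - V₂ b) ^ 2 + (U₁ b - U₂ b) ^ 2 ≤ 0 := by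
    by_contra hc
    exact absurd hle (not_le.2 (mul_pos (not_le.1 hc) (Real.exp_pos _)))
  have hV := sq_nonneg (V₁ b - V₂ b)
  have hU := sq_nonneg (U₁ b - U₂ b)
  exact ⟨sub_eq_zero.1 (pow_eq_zero_iff two_ne_zero |>.1 (by linarith)),
    sub_eq_zero.1 (pow_eq_zero_iff two_ne_zero |>.1 (by linarith))⟩

/-- Since `w'/w = h ≥ h b` up to `b`, the product `w(r) exp (-h(b) r)` is nondecreasing. The
resulting almost-monotonicity of `w` controls quotients `w s / w t` even when `w R = 0`. -/
theorem HalfWeight.exists_le_mul {w h : ℝ → ℝ} {R b : ℝ} {S : Set ℝ} (hS : HalfDomain R S)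
    (hw : HalfWeight w h R S) (hb : b ∈ S) :
    ∃ C : ℝ, 0 < C ∧ ∀ s t, R ≤ s → s ≤ t → t ≤ b → R < t → w s ≤ C * w t := by
  have hRb := hS.lt b hb
  have hsub := hS.Icc_subset hb
  have hder : ∀ r ∈ Set.Ioo R b, HasDerivAt (fun r => w r * Real.exp (-h b * r))
      ((h r * w r) * Real.exp (-h b * r) + w r * (Real.exp (-h b * r) * -h b)) r := by
    intro r hr
    have e3 : HasDerivAt (fun r => Real.exp (-h b * r)) (Real.exp (-h b * r) * -h b) r := by
      simpa using ((hasDerivAt_id r).const_mul (-h b)).exp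
    exact (hw.deriv r (hS.Ioc_subset b hb ⟨hr.1, hr.2.le⟩)).mul e3
  have hmono : MonotoneOn (fun r => w r * Real.exp (-h b * r)) (Icc R b) := by
    refine monotoneOn_of_deriv_nonneg (convex_Icc R b) ?_ ?_ ?_
    · exact ((hw.continuousOn hS).mono hsub).mul (by fun_prop)
    · rw [interior_Icc]
      exact fun r hr => (hder r hr).differentiableAt.differentiableWithinAt
    · rw [interior_Icc]
      intro r hr
      rw [(hder r hr).deriv]
      have hrS : r ∈ S := hS.Ioc_subset b hb ⟨hr.1, hr.2.le⟩
      have h1 : h b ≤ h r := hw.anti.antitoneOn hrS hb hr.2.le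
      have h2 : 0 ≤ (h r - h b) * (w r * Real.exp (-h b * r)) :=
        mul_nonneg (by linarith) (mul_pos (hw.pos r hrS) (Real.exp_pos _)).le
      linarith
  refine ⟨Real.exp (|h b| * (b - R)), Real.exp_pos _, fun s t hs hst ht hRt => ?_⟩
  have h1 := hmono ⟨hs, hst.trans ht⟩ ⟨hs.trans hst, ht⟩ hst
  simp only at h1
  have h2 : w s ≤ w t * Real.exp (-h b * (t - s)) := by
    have : Real.exp (-h b * (t - s)) = Real.exp (-h b * t) / Real.exp (-h b * s) := by
      rw [← Real.exp_sub]; ring_nf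
    rw [this, mul_div_assoc', le_div_iff₀ (Real.exp_pos _)]
    exact h1
  refine h2.trans ?_
  rw [mul_comm]
  refine mul_le_mul_of_nonneg_right (Real.exp_le_exp.2 ?_)
    (hw.pos t (hS.Ioc_subset b hb ⟨hRt, ht⟩)).le
  calc -h b * (t - s) ≤ |h b| * (t - s) :=
        mul_le_mul_of_nonneg_right (neg_le_abs _) (by linarith)
    _ ≤ |h b| * (b - R) := mul_le_mul_of_nonneg_left (by linarith) (abs_nonneg _)

theorem norm_integral_le_of_bound {g B B' : ℝ → ℝ} {R t : ℝ} (hg : Continuous g)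
    (hB0 : 0 ≤ B R) (hB : ∀ x, HasDerivAt B (B' x) x) (hgB : ∀ x ∈ Ico R t, |g x| ≤ B' x)
    (hRt : R ≤ t) : |∫ x in R..t, g x| ≤ B t := by
  have hd : ∀ x, HasDerivAt (fun t => ∫ x in R..t, g x) (g x) x :=
    fun x => (hg.integral_hasStrictDerivAt R x).hasDerivAt
  refine image_norm_le_of_norm_deriv_right_le_deriv_boundary (f := fun t => ∫ x in R..t, g x)
    (f' := g) (a := R) (b := t) (fun x _ => (hd x).continuousAt.continuousWithinAt)
    (fun x _ => (hd x).hasDerivWithinAt) ?_ hB (fun x hx => hgB x hx) ⟨hRt, le_rfl⟩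
  simpa using hB0

/-- The system is equivalent to `U(r) = M - ∫_R^r w(t)⁻¹ ∫_R^t w F(U)`. By `w x ≤ C w t` for `x ≤
t`, the inner quotient is `O(t - R)`, so it extends continuously by `0` to `R` whether or not `w R`
vanishes. Banach's fixed point theorem applies to `W(r) = exp (-λ r) U(r)`, an exponentially
weighted sup norm in disguise, and so gives a solution on the whole of `(R, b)`. -/
theorem exists_halfSolution_Ioo {w h F : ℝ → ℝ} {R b : ℝ} (M : ℝ) {S : Set ℝ} {L : ℝ}
    (hS : HalfDomain R S) (hw : HalfWeight w h R S) (hb : b ∈ S) (hL : 0 ≤ L)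
    (hF : ∀ x y, |F x - F y| ≤ L * |x - y|) :
    ∃ U V, HalfSolution h F R M (Set.Ioo R b) U V := by
  have hRb := hS.lt b hb
  have hsub := hS.Icc_subset hb
  have hwc : ContinuousOn w (Icc R b) := (hw.continuousOn hS).mono hsub
  have hwpos : ∀ t, R < t → t ≤ b → 0 < w t := fun t h1 h2 => hw.pos t (hS.Ioc_subset b hb ⟨h1, h2⟩)
  obtain ⟨C, hC, hwC⟩ := hw.exists_le_mul hS hb
  have hFc : Continuous F := by
    refine (LipschitzWith.of_dist_le_mul (K := ⟨L, hL⟩) fun x y => ?_).continuous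
    rw [Real.dist_eq, Real.dist_eq]
    exact hF x y
  -- Each of the two integrations gains a factor `1 / lam`, so the Lipschitz constant is `C L /
  -- lam²`, which this choice makes at most `1 / 2`.
  set lam : ℝ := Real.sqrt (2 * C * L + 1) with hlam
  have hlam2 : lam ^ 2 = 2 * C * L + 1 := Real.sq_sqrt (by positivity)
  have hlam0 : 0 < lam := Real.sqrt_pos.2 (by positivity)
  -- Constant extension beyond the endpoints makes every integrand continuous on `ℝ`, so the
  -- fundamental theorem of calculus needs no endpoint cases.
  let wc : ℝ → ℝ := IccExtend hRb.le ((Icc R b).domRestrict w)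
  have hwcc : Continuous wc := hwc.domRestrict.Icc_extend'
  have hwce : ∀ t ∈ Icc R b, wc t = w t := fun t ht => IccExtend_of_mem _ _ ht
  have hwnn : ∀ t ∈ Icc R b, 0 ≤ w t := by
    intro t ht
    have hcl : Icc R b ⊆ closure (Set.Ioc R b) := by rw [closure_Ioc hRb.ne]
    rcases ht.1.eq_or_lt with h | h
    · subst h
      have : Tendsto w (𝓝[>] R) (𝓝 (w R)) := hw.cont.mono Ioi_subset_Ici_self
      refine ge_of_tendsto this ?_
      filter_upwards [Ioc_mem_nhdsGT hRb] with x hx using (hwpos x hx.1 hx.2).le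
    · exact (hwpos t h ht.2).le
  let u : C(Icc R b, ℝ) → ℝ → ℝ := fun W t => Real.exp (lam * t) * IccExtend hRb.le W t
  have huc : ∀ W, Continuous (u W) := fun W => by
    have := W.continuous.Icc_extend' (h := hRb.le)
    fun_prop
  let g : C(Icc R b, ℝ) → ℝ → ℝ := fun W t => wc t * F (u W t)
  have hgc : ∀ W, Continuous (g W) := fun W => by
    have := huc W
    fun_prop
  let Q : C(Icc R b, ℝ) → ℝ → ℝ := fun W t => ∫ x in R..t, g W x
  have hQd : ∀ W x, HasDerivAt (Q W) (g W x) x :=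
    fun W x => ((hgc W).integral_hasStrictDerivAt R x).hasDerivAt
  have hAc : ∀ W, ContinuousOn (fun t => Q W t / w t) (Icc R b) := by
    intro W t ht
    rcases ht.1.eq_or_lt with h | h
    · subst h
      obtain ⟨B, hB⟩ := isCompact_Icc.exists_bound_of_continuousOn
        (hFc.comp (huc W)).continuousOn (s := Icc R b)
      have hB0 : 0 ≤ B := (norm_nonneg _).trans (hB R ht)
      have hbd : ∀ t ∈ Icc R b, ‖Q W t / w t - Q W R / w R‖ ≤ C * B * (t - R) := by
        intro t ht
        have hQR : Q W R = 0 := by simp [Q]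
        rw [hQR, zero_div, sub_zero]
        rcases ht.1.eq_or_lt with h | h
        · subst h; simp [hQR]
        have h1 : |Q W t| ≤ C * w t * B * (t - R) := by
          refine norm_integral_le_of_bound (B := fun x => C * w t * B * (x - R))
            (B' := fun _ => C * w t * B) (hgc W) (by simp) (fun x => ?_) (fun x hx => ?_) ht.1
          · simpa using ((hasDerivAt_id x).sub_const R).const_mul (C * w t * B)
          · have hx' : x ∈ Icc R b := ⟨hx.1, hx.2.le.trans ht.2⟩
            simp only [g]
            rw [hwce x hx', abs_mul, abs_of_nonneg (hwnn x hx')]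
            exact mul_le_mul (hwC x t hx.1 hx.2.le ht.2 h) (hB x hx') (abs_nonneg _)
              (mul_pos hC (hwpos t h ht.2)).le
        have h2 := hwpos t h ht.2
        rw [Real.norm_eq_abs, abs_div, abs_of_pos h2, div_le_iff₀ h2]
        linarith
      have ht0 : Tendsto (fun t => C * B * (t - R)) (𝓝[Icc R b] R) (𝓝 0) := by
        have : Continuous fun t => C * B * (t - R) := by fun_prop
        simpa using (this.tendsto R).mono_left nhdsWithin_le_nhds
      rw [ContinuousWithinAt, tendsto_iff_norm_sub_tendsto_zero]
      refine squeeze_zero' (Eventually.of_forall fun _ => norm_nonneg _) ?_ ht0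
      filter_upwards [self_mem_nhdsWithin] with t ht using hbd t ht
    · exact (hQd W t).continuousAt.continuousWithinAt.div (hwc t ht) (hwpos t h ht.2).ne'
  let A : C(Icc R b, ℝ) → ℝ → ℝ := fun W =>
    IccExtend hRb.le ((Icc R b).domRestrict fun t => Q W t / w t)
  have hA : ∀ W, Continuous (A W) := fun W => (hAc W).domRestrict.Icc_extend'
  have hAe : ∀ W, ∀ t ∈ Icc R b, A W t = Q W t / w t := fun W t ht => IccExtend_of_mem _ _ ht
  let Y : C(Icc R b, ℝ) → ℝ → ℝ := fun W r => M - ∫ x in R..r, A W x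
  have hYd : ∀ W x, HasDerivAt (Y W) (-(A W x)) x :=
    fun W x => (((hA W).integral_hasStrictDerivAt R x).hasDerivAt).const_sub M
  have hYc : ∀ W, Continuous (Y W) := fun W => continuous_iff_continuousAt.2
    fun x => (hYd W x).continuousAt
  let T : C(Icc R b, ℝ) → C(Icc R b, ℝ) := fun W =>
    ⟨fun r => Real.exp (-(lam * r)) * Y W r, by have := hYc W; fun_prop⟩
  have hexp : ∀ c x : ℝ, HasDerivAt (fun x => c * Real.exp (lam * x) / lam)
      (c * Real.exp (lam * x)) x := by
    intro c x
    have e3 : HasDerivAt (fun r => Real.exp (lam * r)) (Real.exp (lam * x) * lam) x := by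
      simpa using ((hasDerivAt_id x).const_mul lam).exp
    refine ((e3.const_mul c).div_const lam).congr_deriv ?_
    field_simp
  have hcon : ContractingWith (1 / 2) T := by
    refine ⟨by rw [← NNReal.coe_lt_coe]; norm_num, LipschitzWith.of_dist_le_mul fun W₁ W₂ => ?_⟩
    set d := dist W₁ W₂ with hd
    have hd0 : 0 ≤ d := dist_nonneg
    have hu : ∀ x, |u W₁ x - u W₂ x| ≤ Real.exp (lam * x) * d := by
      intro x
      simp only [u]
      rw [← mul_sub, abs_mul, abs_of_pos (Real.exp_pos _)]
      refine mul_le_mul_of_nonneg_left ?_ (Real.exp_pos _).le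
      exact ContinuousMap.dist_apply_le_dist (f := W₁) (g := W₂) (projIcc R b hRb.le x)
    have hQ : ∀ t ∈ Icc R b, R < t → |Q W₁ t - Q W₂ t| ≤
        (C * w t * L * d) * Real.exp (lam * t) / lam := by
      intro t ht hRt
      have hwt := hwpos t hRt ht.2
      have : Q W₁ t - Q W₂ t = ∫ x in R..t, (g W₁ x - g W₂ x) :=
        (intervalIntegral.integral_sub ((hgc W₁).intervalIntegrable _ _)
          ((hgc W₂).intervalIntegrable _ _)).symm
      rw [this]
      refine norm_integral_le_of_bound (B := fun t' => (C * w t * L * d) * Real.exp (lam * t') / lam)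
        ((hgc W₁).sub (hgc W₂)) (by positivity) (fun x => hexp _ x) (fun x hx => ?_) ht.1
      have hx' : x ∈ Icc R b := ⟨hx.1, hx.2.le.trans ht.2⟩
      simp only [g]
      rw [← mul_sub, abs_mul, hwce x hx', abs_of_nonneg (hwnn x hx')]
      calc w x * |F (u W₁ x) - F (u W₂ x)|
          ≤ (C * w t) * (L * (Real.exp (lam * x) * d)) := by
            refine mul_le_mul (hwC x t hx.1 hx.2.le ht.2 hRt) ?_ (abs_nonneg _) (by positivity)
            exact (hF _ _).trans (mul_le_mul_of_nonneg_left (hu x) hL)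
        _ = _ := by ring
    have hAd : ∀ t ∈ Icc R b, |A W₁ t - A W₂ t| ≤ (C * L * d / lam) * Real.exp (lam * t) := by
      intro t ht
      rw [hAe W₁ t ht, hAe W₂ t ht]
      rcases ht.1.eq_or_lt with h | h
      · subst h
        have : ∀ W, Q W R = 0 := fun W => by simp [Q]
        rw [this, this]
        simp only [zero_div, sub_zero, abs_zero]
        positivity
      · have hwt := hwpos t h ht.2
        rw [← sub_div, abs_div, abs_of_pos hwt, div_le_iff₀ hwt]
        refine (hQ t ht h).trans (le_of_eq ?_)
        ring
    rw [ContinuousMap.dist_le (by positivity)]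
    rintro ⟨r, hr⟩
    have hYr : |Y W₁ r - Y W₂ r| ≤ (C * L * d / lam) * Real.exp (lam * r) / lam := by
      have : Y W₂ r - Y W₁ r = ∫ x in R..r, (A W₁ x - A W₂ x) := by
        rw [intervalIntegral.integral_sub ((hA W₁).intervalIntegrable _ _)
          ((hA W₂).intervalIntegrable _ _)]
        simp only [Y]
        ring
      rw [abs_sub_comm, this]
      exact norm_integral_le_of_bound (B := fun t' => (C * L * d / lam) * Real.exp (lam * t') / lam)
        ((hA W₁).sub (hA W₂)) (by positivity) (fun x => hexp _ x)
        (fun x hx => hAd x ⟨hx.1, hx.2.le.trans hr.2⟩) hr.1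
    have h1 : dist (T W₁ ⟨r, hr⟩) (T W₂ ⟨r, hr⟩) = Real.exp (-(lam * r)) * |Y W₁ r - Y W₂ r| := by
      simp only [T, ContinuousMap.coe_mk, Real.dist_eq]
      rw [← mul_sub, abs_mul, abs_of_pos (Real.exp_pos _)]
    rw [h1]
    calc Real.exp (-(lam * r)) * |Y W₁ r - Y W₂ r|
        ≤ Real.exp (-(lam * r)) * ((C * L * d / lam) * Real.exp (lam * r) / lam) :=
          mul_le_mul_of_nonneg_left hYr (Real.exp_pos _).le
      _ = C * L / lam ^ 2 * d := by
          rw [Real.exp_neg]; field_simp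
      _ ≤ ((1 / 2 : NNReal) : ℝ) * d := by
          refine mul_le_mul_of_nonneg_right ?_ hd0
          rw [hlam2, div_le_iff₀ (by positivity)]
          push_cast
          linarith
  obtain ⟨W, hW⟩ : ∃ W, T W = W := ⟨_, hcon.fixedPoint_isFixedPt⟩
  have hUW : ∀ r ∈ Icc R b, u W r = Y W r := by
    intro r hr
    have h1 : Real.exp (-(lam * r)) * Y W r = W ⟨r, hr⟩ := DFunLike.congr_fun hW ⟨r, hr⟩
    simp only [u]
    rw [IccExtend_of_mem _ _ hr, ← h1, Real.exp_neg]
    field_simp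
  refine ⟨Y W, fun r => -(A W r), (hYc W).continuousOn, (hA W).neg.continuousOn, ?_, ?_,
    fun r _ => hYd W r, fun r hr => ?_⟩
  · simp [Y]
  · rw [hAe W R (left_mem_Icc.2 hRb.le)]
    simp [Q]
  · have hr' : r ∈ Icc R b := ⟨hr.1.le, hr.2.le⟩
    have hwr := hwpos r hr.1 hr.2.le
    have hev : (fun r => -(A W r)) =ᶠ[𝓝 r] fun r => -(Q W r / w r) := by
      filter_upwards [isOpen_Ioo.mem_nhds hr] with x hx
      rw [hAe W x ⟨hx.1.le, hx.2.le⟩]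
    have hder := ((hQd W r).div (hw.deriv r (hS.Ioc_subset b hb ⟨hr.1, hr.2.le⟩)) hwr.ne').neg
    refine (hder.congr_of_eventuallyEq hev).congr_deriv ?_
    simp only [g]
    rw [hAe W r hr', hwce r hr', hUW r hr']
    field_simp
    ring

/-- Gluing of the solutions on the intervals `(R, b)`, `b ∈ S`. -/
theorem exists_halfSolution {w h F : ℝ → ℝ} {R : ℝ} (M : ℝ) {S : Set ℝ} {L : ℝ}
    (hS : HalfDomain R S) (hw : HalfWeight w h R S) (hL : 0 ≤ L)
    (hF : ∀ x y, |F x - F y| ≤ L * |x - y|) :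
    ∃ U V, HalfSolution h F R M S U V := by
  have hFB : BoundedLipschitz F := fun B => ⟨L, hL, fun x y _ _ => hF x y⟩
  -- Choosing `b` strictly beyond `r` makes `r` interior to `(R, b)`, so derivatives at `r` can be
  -- read off from the solution there.
  have hnext : ∀ r : ℝ, ∃ b, r ∈ S → b ∈ S ∧ r < b := by
    intro r
    by_cases hr : r ∈ S
    · obtain ⟨b, hb, hbS⟩ := mem_nhdsGT_iff_exists_Ioc_subset.1
        (mem_nhdsWithin_of_mem_nhds (hS.isOpen.mem_nhds hr))
      exact ⟨b, fun _ => ⟨hbS ⟨hb, le_rfl⟩, hb⟩⟩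
    · exact ⟨0, fun h => absurd h hr⟩
  choose β hβ using hnext
  have hex : ∀ b : ℝ, ∃ UV : (ℝ → ℝ) × (ℝ → ℝ),
      b ∈ S → HalfSolution h F R M (Set.Ioo R b) UV.1 UV.2 := by
    intro b
    by_cases hb : b ∈ S
    · obtain ⟨U, V, hUV⟩ := exists_halfSolution_Ioo M hS hw hb hL hF
      exact ⟨(U, V), fun _ => hUV⟩
    · exact ⟨(0, 0), fun h => absurd h hb⟩
  choose G hG using hex
  have hagree : ∀ b ∈ S, ∀ c ∈ S, ∀ r, R < r → r < b → r < c →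
      (G b).1 r = (G c).1 r ∧ (G b).2 r = (G c).2 r := by
    intro b hb c hc r hr hrb hrc
    have hsb : Set.Ioo R (min b c) ⊆ Set.Ioo R b := Ioo_subset_Ioo_right (min_le_left _ _)
    have hsc : Set.Ioo R (min b c) ⊆ Set.Ioo R c := Ioo_subset_Ioo_right (min_le_right _ _)
    refine HalfSolution.eqOn HalfDomain.Ioo (hw.anti.antitoneOn.mono ?_) hFB ((hG b hb).mono hsb)
      ((hG c hc).mono hsc) r (Or.inr ⟨hr, lt_min hrb hrc⟩)
    exact fun x hx => hS.Ioc_subset b hb ⟨hx.1, (hsb hx).2.le⟩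
  let U : ℝ → ℝ := fun r => if r = R then M else (G (β r)).1 r
  let V : ℝ → ℝ := fun r => if r = R then 0 else (G (β r)).2 r
  have heq : ∀ b ∈ S, ∀ r ∈ insert R (Set.Ioo R b), U r = (G b).1 r ∧ V r = (G b).2 r := by
    rintro b hb r (rfl | hr)
    · simp [U, V, (hG b hb).value, (hG b hb).slope]
    · have hrS : r ∈ S := hS.Ioc_subset b hb ⟨hr.1, hr.2.le⟩
      have hne : r ≠ R := hr.1.ne'
      simp only [U, V, if_neg hne]
      exact hagree _ (hβ r hrS).1 b hb r hr.1 (hβ r hrS).2 hr.2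
  have hevent : ∀ b ∈ S, ∀ r ∈ Set.Ioo R b, U =ᶠ[𝓝 r] (G b).1 ∧ V =ᶠ[𝓝 r] (G b).2 := by
    intro b hb r hr
    have := isOpen_Ioo.mem_nhds hr
    constructor
    · filter_upwards [this] with x hx using (heq b hb x (Or.inr hx)).1
    · filter_upwards [this] with x hx using (heq b hb x (Or.inr hx)).2
  have hdU : ∀ r ∈ S, HasDerivAt U (V r) r := by
    intro r hr
    have hrb : r ∈ Set.Ioo R (β r) := ⟨hS.lt r hr, (hβ r hr).2⟩
    rw [(heq _ (hβ r hr).1 r (Or.inr hrb)).2]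
    exact ((hG _ (hβ r hr).1).derivU r hrb).congr_of_eventuallyEq (hevent _ (hβ r hr).1 r hrb).1
  have hdV : ∀ r ∈ S, HasDerivAt V (-(h r * V r) - F (U r)) r := by
    intro r hr
    have hrb : r ∈ Set.Ioo R (β r) := ⟨hS.lt r hr, (hβ r hr).2⟩
    rw [(heq _ (hβ r hr).1 r (Or.inr hrb)).2, (heq _ (hβ r hr).1 r (Or.inr hrb)).1]
    exact ((hG _ (hβ r hr).1).derivV r hrb).congr_of_eventuallyEq (hevent _ (hβ r hr).1 r hrb).2
  have hR : ∀ b ∈ S, insert R (Set.Ioo R b) ∈ 𝓝[insert R S] R := by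
    intro b hb
    have h1 : Set.Iio b ∈ 𝓝[insert R S] R :=
      mem_nhdsWithin_of_mem_nhds (Iio_mem_nhds (hS.lt b hb))
    filter_upwards [h1, self_mem_nhdsWithin] with x hx hx'
    rcases hx' with h | h
    · exact Or.inl h
    · exact Or.inr ⟨hS.lt x h, hx⟩
  refine ⟨U, V, ?_, ?_, by simp [U], by simp [V], hdU, hdV⟩
  · rintro r (rfl | hr)
    · rcases S.eq_empty_or_nonempty with rfl | ⟨b, hb⟩
      · simp
      · have h1 : ContinuousWithinAt U (insert r (Set.Ioo r b)) r :=
          ((hG b hb).contU r (mem_insert _ _)).congr (fun x hx => (heq b hb x hx).1)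
            (heq b hb r (mem_insert _ _)).1
        exact h1.mono_of_mem_nhdsWithin (hR b hb)
    · exact (hdU r hr).continuousAt.continuousWithinAt
  · rintro r (rfl | hr)
    · rcases S.eq_empty_or_nonempty with rfl | ⟨b, hb⟩
      · simp
      · have h1 : ContinuousWithinAt V (insert r (Set.Ioo r b)) r :=
          ((hG b hb).contV r (mem_insert _ _)).congr (fun x hx => (heq b hb x hx).2)
            (heq b hb r (mem_insert _ _)).2
        exact h1.mono_of_mem_nhdsWithin (hR b hb)
    · exact (hdV r hr).continuousAt.continuousWithinAt

/-! ### Branches down to the first zero, and their inverse functions. -/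

/-- `(U, V)` solves the system on `(R, q)` with `V < 0` there, and `p ∈ (R, q)` is the zero
of `U`. -/
structure RightBranch (h f : ℝ → ℝ) (R M p q : ℝ) (U V : ℝ → ℝ) : Prop where
  sol : HalfSolution h f R M (Ioo R q) U V
  lt_p : R < p
  lt_q : p < q
  zero : U p = 0
  pos : ∀ r ∈ Ico R p, 0 < U r
  slope_neg : ∀ r ∈ Ioo R q, V r < 0

/-- The weight is an integrating factor: `(w V)' = -w F(U)`. -/
theorem HalfSolution.weighted_slope_strictAntiOn {w h F : ℝ → ℝ} {R M b : ℝ} {S : Set ℝ}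
    {U V : ℝ → ℝ} (hS : HalfDomain R S) (hw : HalfWeight w h R S) (hU : HalfSolution h F R M S U V)
    (hb : b ∈ S) (hF : ∀ r ∈ Ioo R b, 0 < F (U r)) :
    StrictAntiOn (fun r => w r * V r) (Icc R b) := by
  have hsub := hS.Icc_subset hb
  refine strictAntiOn_of_deriv_neg (convex_Icc R b)
    (((hw.continuousOn hS).mono hsub).mul (hU.contV.mono hsub)) fun r hr => ?_
  rw [interior_Icc] at hr
  have hrS : r ∈ S := hS.Ioc_subset b hb ⟨hr.1, hr.2.le⟩
  have hder : HasDerivAt (fun r => w r * V r) _ r := (hw.deriv r hrS).mul (hU.derivV r hrS)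
  rw [hder.deriv]
  have := mul_pos (hw.pos r hrS) (hF r hr)
  linarith

theorem HalfSolution.slope_neg {w h F : ℝ → ℝ} {R M b : ℝ} {S : Set ℝ}
    {U V : ℝ → ℝ} (hS : HalfDomain R S) (hw : HalfWeight w h R S) (hU : HalfSolution h F R M S U V)
    (hb : b ∈ S) (hF : ∀ r ∈ Ioo R b, 0 < F (U r)) : V b < 0 := by
  have hRb := hS.lt b hb
  have h1 := hU.weighted_slope_strictAntiOn hS hw hb hF (left_mem_Icc.2 hRb.le)
    (right_mem_Icc.2 hRb.le) hRb
  simp only [hU.slope, mul_zero] at h1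
  exact neg_of_mul_neg_right h1 (hw.pos b hb).le

/-- If `U` stayed positive, `w V` would remain below its negative value `-c` at an interior point.
Then `V ≤ -(c / K) / (e - r)`, and integration gives `U → -∞` like `log (e - r)`, a contradiction.
-/
theorem HalfSolution.exists_nonpos_of_finite {w h F : ℝ → ℝ} {R M e K : ℝ} {U V : ℝ → ℝ}
    (hw : HalfWeight w h R (Ioo R e)) (hU : HalfSolution h F R M (Ioo R e) U V)
    (hF : ∀ x, 0 < x → 0 < F x) (hRe : R < e) (hK : 0 < K)
    (hwK : ∀ r ∈ Ioo R e, w r ≤ K * (e - r)) : ∃ r ∈ Ioo R e, U r ≤ 0 := by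
  by_contra! hpos
  have hS : HalfDomain R (Ioo R e) := HalfDomain.Ioo
  set a : ℝ := (R + e) / 2 with ha
  have haS : a ∈ Ioo R e := ⟨by linarith, by linarith⟩
  have hFU : ∀ b ∈ Ioo R e, ∀ r ∈ Ioo R b, 0 < F (U r) := fun b hb r hr =>
    hF _ (hpos r ⟨hr.1, hr.2.trans hb.2⟩)
  set c : ℝ := -(w a * V a) with hc
  have hc0 : 0 < c := by
    have := mul_pos (hw.pos a haS) (neg_pos.2 (hU.slope_neg hS hw haS (hFU a haS)))
    linarith
  have hV : ∀ r ∈ Ico a e, V r ≤ -(c / K) / (e - r) := by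
    intro r hr
    have hrS : r ∈ Ioo R e := ⟨haS.1.trans_le hr.1, hr.2⟩
    have h1 := (hU.weighted_slope_strictAntiOn hS hw hrS (hFU r hrS)).antitoneOn
      ⟨haS.1.le, hr.1⟩ ⟨hrS.1.le, le_rfl⟩ hr.1
    have her : 0 < e - r := by linarith [hr.2]
    have hVn := hU.slope_neg hS hw hrS (hFU r hrS)
    rw [le_div_iff₀ her, ← neg_le_neg_iff, neg_neg, div_le_iff₀ hK]
    have h2 : w r * (-V r) ≤ K * (e - r) * (-V r) :=
      mul_le_mul_of_nonneg_right (hwK r hrS) (by linarith)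
    linarith
  have hcont : ∀ b ∈ Ioo a e, U b - c / K * Real.log (e - b) ≤ U a - c / K * Real.log (e - a) := by
    intro b hb
    have hder : ∀ r ∈ Ico a e, HasDerivAt (fun r => U r - c / K * Real.log (e - r))
        (V r - c / K * (-1 / (e - r))) r := by
      intro r hr
      have hrS : r ∈ Ioo R e := ⟨haS.1.trans_le hr.1, hr.2⟩
      have her : e - r ≠ 0 := by linarith [hr.2]
      exact (hU.derivU r hrS).sub ((((hasDerivAt_id r).const_sub e).log her).const_mul (c / K))
    refine antitoneOn_of_deriv_nonpos (f := fun r => U r - c / K * Real.log (e - r))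
      (convex_Icc a b) (fun r hr => ?_) (fun r hr => ?_) (fun r hr => ?_)
      (left_mem_Icc.2 hb.1.le) (right_mem_Icc.2 hb.1.le) hb.1.le
    · exact (hder r ⟨hr.1, hr.2.trans_lt hb.2⟩).continuousAt.continuousWithinAt
    · rw [interior_Icc] at hr
      exact (hder r ⟨hr.1.le, hr.2.trans hb.2⟩).differentiableAt.differentiableWithinAt
    · rw [interior_Icc] at hr
      have hr' : r ∈ Ico a e := ⟨hr.1.le, hr.2.trans hb.2⟩
      rw [(hder r hr').deriv]
      have h1 := hV r hr'
      have h2 : c / K * (-1 / (e - r)) = -(c / K) / (e - r) := by ring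
      rw [h2]
      linarith
  have hlim : Tendsto (fun b => U a - c / K * Real.log (e - a) + c / K * Real.log (e - b))
      (𝓝[<] e) atBot := by
    refine tendsto_atBot_add_const_left _ _ (Tendsto.const_mul_atBot (by positivity) ?_)
    refine Real.tendsto_log_nhdsGT_zero.comp ?_
    refine tendsto_nhdsWithin_iff.2 ⟨?_, ?_⟩
    · have : Continuous fun b : ℝ => e - b := by fun_prop
      simpa using (this.tendsto e).mono_left (nhdsWithin_le_nhds (s := Iio e))
    · filter_upwards [self_mem_nhdsWithin] with b hb
      exact sub_pos.2 (show b < e from hb)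
  obtain ⟨b, hb1, hb2⟩ := ((hlim.eventually (eventually_le_atBot 0)).and
    (Ioo_mem_nhdsLT haS.2)).exists
  linarith [hcont b hb2, hpos b ⟨haS.1.trans hb2.1, hb2.2⟩]

/-- If `U` stayed positive, a constant negative barrier for `V` would force at least linear decay of
`U`. The barrier exists because `h`, being decreasing, is bounded above away from `R`. -/
theorem HalfSolution.exists_nonpos_of_infinite {w h F : ℝ → ℝ} {R M m : ℝ} {U V : ℝ → ℝ}
    (hw : HalfWeight w h R (Ioi R)) (hU : HalfSolution h F R M (Ioi R) U V)
    (hm : 0 < m) (hF : ∀ x, 0 < x → m ≤ F x) : ∃ r ∈ Ioi R, U r ≤ 0 := by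
  by_contra! hpos
  have hS : HalfDomain R (Ioi R) := HalfDomain.Ioi
  have hFU : ∀ b ∈ Ioi R, ∀ r ∈ Ioo R b, 0 < F (U r) := fun b hb r hr =>
    hm.trans_le (hF _ (hpos r hr.1))
  have haS : R + 1 ∈ Ioi R := by simp
  set a := R + 1 with ha
  set H : ℝ := max (h a) 1 with hH
  have hH0 : 0 < H := zero_lt_one.trans_le (le_max_right _ _)
  -- The first entry puts `V a` below `-c`; the second gives `H c ≤ m / 2`, so at contact with the
  -- barrier `V' = h c - F(U) ≤ m / 2 - m < 0`.
  set c : ℝ := min (-V a) (m / (2 * H)) with hc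
  have hVa := hU.slope_neg hS hw haS (hFU a haS)
  have hc0 : 0 < c := lt_min (by linarith) (by positivity)
  have hcH : H * c ≤ m / 2 := by
    have : c ≤ m / (2 * H) := min_le_right _ _
    calc H * c ≤ H * (m / (2 * H)) := mul_le_mul_of_nonneg_left this hH0.le
      _ = m / 2 := by field_simp
  have hmem : ∀ r, a ≤ r → r ∈ Ioi R := fun r hr => haS.trans_le hr
  have hV : ∀ b, a ≤ b → V b ≤ -c := by
    intro b hb
    refine image_le_of_deriv_right_lt_deriv_boundary (f := V)
      (f' := fun r => -(h r * V r) - F (U r)) (a := a) (b := b) (B := fun _ => -c)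
      (B' := fun _ => 0) ?_ ?_ ?_ (fun x => hasDerivAt_const x _) ?_ (right_mem_Icc.2 hb)
    · exact fun r hr => (hU.derivV r (hmem r hr.1)).continuousAt.continuousWithinAt
    · exact fun r hr => (hU.derivV r (hmem r hr.1)).hasDerivWithinAt
    · linarith [min_le_left (-V a) (m / (2 * H))]
    · intro r hr hVr
      have h1 : h r ≤ H := (hw.anti.antitoneOn haS (hmem r hr.1) hr.1).trans (le_max_left _ _)
      have h2 := hF _ (hpos r (hmem r hr.1))
      simp only [hVr]
      have h3 := mul_le_mul_of_nonneg_right h1 hc0.le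
      linarith
  have hUb : ∀ b, a ≤ b → U b ≤ U a - c * (b - a) := by
    intro b hb
    refine image_le_of_deriv_right_le_deriv_boundary (f := U)
      (f' := V) (a := a) (b := b) (B := fun b => U a - c * (b - a))
      (B' := fun _ => -c) ?_ ?_ ?_ ?_ ?_ ?_ (right_mem_Icc.2 hb)
    · exact fun r hr => (hU.derivU r (hmem r hr.1)).continuousAt.continuousWithinAt
    · exact fun r hr => (hU.derivU r (hmem r hr.1)).hasDerivWithinAt
    · simp
    · fun_prop
    · intro x hx
      have := (((hasDerivAt_id x).sub_const a).const_mul c).const_sub (U a)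
      simpa using this.hasDerivWithinAt
    · exact fun x hx => hV x hx.1
  have hUa := hpos a haS
  have h1 := hUb (a + U a / c) (by have : 0 ≤ U a / c := by positivity
                                   linarith)
  have h2 := hpos (a + U a / c) (hmem _ (by have : 0 ≤ U a / c := by positivity
                                            linarith))
  have h3 : c * (a + U a / c - a) = U a := by field_simp; ring
  linarith

theorem abs_clamp_sub_le (a b x y : ℝ) :
    |max a (min x b) - max a (min y b)| ≤ |x - y| := by
  have h1 : |max a (min x b) - max a (min y b)| ≤ |min x b - min y b| := by
    rw [max_comm a, max_comm a]
    exact abs_max_sub_max_le_abs _ _ _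
  exact h1.trans (by simpa using abs_min_sub_min_le_max x b y b)

/-- Truncating the argument of `f` gives a globally Lipschitz nonlinearity, hence a solution on all
of `S`, which must reach zero. Up to the zero `U` decreases from `M`, so the truncation is inactive
there, and by continuity also slightly past the zero. -/
theorem exists_rightBranch {w h f : ℝ → ℝ} {R M : ℝ} {S : Set ℝ}
    (hS : HalfDomain R S) (hw : HalfWeight w h R S) (hf : BoundedLipschitz f) (hM : 0 < M)
    (hfpos : ∀ x ∈ Ioc 0 M, 0 < f x)
    (hend : (∃ K e, 0 < K ∧ R < e ∧ S = Ioo R e ∧ ∀ r ∈ S, w r ≤ K * (e - r)) ∨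
      (S = Ioi R ∧ ∃ m, 0 < m ∧ ∀ x ∈ Ioc 0 M, m ≤ f x)) :
    ∃ p q U V, RightBranch h f R M p q U V ∧ Ioo R q ⊆ S := by
  obtain ⟨L, hL, hfL⟩ := hf (max 1 M)
  -- Clamping at `-1` rather than `0` leaves room to continue past the zero with the original `f`.
  let F : ℝ → ℝ := fun x => f (max (-1) (min x M))
  have hcl : ∀ x, |max (-1) (min x M)| ≤ max 1 M := by
    intro x
    rw [abs_le]
    constructor
    · exact (neg_le_neg (le_max_left 1 M)).trans (le_max_left _ _)
    · exact max_le (by linarith [le_max_right 1 M]) ((min_le_right _ _).trans (le_max_right _ _))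
  have hF : ∀ x y, |F x - F y| ≤ L * |x - y| := fun x y =>
    (hfL _ _ (hcl x) (hcl y)).trans (mul_le_mul_of_nonneg_left (abs_clamp_sub_le _ _ _ _) hL)
  have hclpos : ∀ x, 0 < x → max (-1) (min x M) ∈ Ioc 0 M := fun x hx =>
    ⟨lt_max_of_lt_right (lt_min hx hM), max_le (by linarith) (min_le_right _ _)⟩
  have hFpos : ∀ x, 0 < x → 0 < F x := fun x hx => hfpos _ (hclpos x hx)
  obtain ⟨U, V, hU⟩ := exists_halfSolution (F := F) M hS hw hL hF
  obtain ⟨b, hbS, hb⟩ : ∃ r ∈ S, U r ≤ 0 := by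
    rcases hend with ⟨K, e, hK, hRe, rfl, hwK⟩ | ⟨rfl, m, hm, hfm⟩
    · exact hU.exists_nonpos_of_finite hw hFpos hRe hK hwK
    · exact hU.exists_nonpos_of_infinite hw hm fun x hx => hfm _ (hclpos x hx)
  have hRb := hS.lt b hbS
  have hUc : ContinuousOn U (Icc R b) := hU.contU.mono (hS.Icc_subset hbS)
  have hcomp : IsCompact {r ∈ Icc R b | U r ≤ 0} :=
    isCompact_Icc.of_isClosed_subset (hUc.preimage_isClosed_of_isClosed isClosed_Icc isClosed_Iic)
      (sep_subset _ _)
  obtain ⟨p, ⟨hpI, hp0⟩, hpmin⟩ := hcomp.exists_isLeast ⟨b, ⟨hRb.le, le_rfl⟩, hb⟩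
  have hpos : ∀ r ∈ Ico R p, 0 < U r := by
    intro r hr
    by_contra hc
    exact absurd (hpmin ⟨⟨hr.1, hr.2.le.trans hpI.2⟩, not_lt.1 hc⟩) (not_le.2 hr.2)
  have hRp : R < p := by
    refine lt_of_le_of_ne hpI.1 fun h => ?_
    rw [← h, hU.value] at hp0
    linarith
  have hpS : p ∈ S := hS.Ioc_subset b hbS ⟨hRp, hpI.2⟩
  have hVneg : ∀ r ∈ Ioc R p, V r < 0 := fun r hr =>
    hU.slope_neg hS hw (hS.Ioc_subset p hpS hr) fun x hx =>
      hFpos _ (hpos x ⟨hx.1.le, hx.2.trans_le hr.2⟩)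
  have hUp : U p = 0 := by
    refine le_antisymm hp0 ?_
    have h1 : Tendsto U (𝓝[<] p) (𝓝 (U p)) :=
      (hU.derivU p hpS).continuousAt.tendsto.mono_left nhdsWithin_le_nhds
    refine ge_of_tendsto h1 ?_
    filter_upwards [Ioo_mem_nhdsLT hRp] with x hx using (hpos x ⟨hx.1.le, hx.2⟩).le
  have hnear : ∀ᶠ r in 𝓝 p, V r < 0 ∧ -1 < U r ∧ U r < M ∧ r ∈ S := by
    have h1 := (hU.derivV p hpS).continuousAt.eventually_lt continuousAt_const
      (hVneg p ⟨hRp, le_rfl⟩)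
    have h2 := continuousAt_const.eventually_lt (hU.derivU p hpS).continuousAt
      (show (-1 : ℝ) < U p by rw [hUp]; norm_num)
    have h3 := (hU.derivU p hpS).continuousAt.eventually_lt continuousAt_const
      (show U p < M by rw [hUp]; exact hM)
    filter_upwards [h1, h2, h3, hS.isOpen.mem_nhds hpS] with r a1 a2 a3 a4 using ⟨a1, a2, a3, a4⟩
  obtain ⟨ε, hε, hball⟩ := Metric.eventually_nhds_iff.1 hnear
  have hafter : ∀ r, p ≤ r → r < p + ε → V r < 0 ∧ -1 < U r ∧ U r < M ∧ r ∈ S := by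
    intro r h1 h2
    refine hball ?_
    rw [Real.dist_eq, abs_of_nonneg (by linarith)]
    linarith
  have hUM : ∀ r ∈ Ioc R p, U r ≤ M := by
    intro r hr
    have hanti : AntitoneOn U (Icc R r) := by
      have hrS := hS.Ioc_subset p hpS hr
      refine antitoneOn_of_deriv_nonpos (convex_Icc R r) (hU.contU.mono (hS.Icc_subset hrS)) ?_ ?_
      · rw [interior_Icc]
        exact fun x hx => (hU.derivU x
          (hS.Ioc_subset r hrS ⟨hx.1, hx.2.le⟩)).differentiableAt.differentiableWithinAt
      · rw [interior_Icc]
        intro x hx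
        rw [(hU.derivU x (hS.Ioc_subset r hrS ⟨hx.1, hx.2.le⟩)).deriv]
        exact (hVneg x ⟨hx.1, hx.2.le.trans hr.2⟩).le
    rw [← hU.value]
    exact hanti (left_mem_Icc.2 hr.1.le) (right_mem_Icc.2 hr.1.le) hr.1.le
  have hall : ∀ r ∈ Ioo R (p + ε), V r < 0 ∧ -1 ≤ U r ∧ U r ≤ M ∧ r ∈ S := by
    intro r hr
    rcases le_total r p with h | h
    · refine ⟨hVneg r ⟨hr.1, h⟩, ?_, hUM r ⟨hr.1, h⟩, hS.Ioc_subset p hpS ⟨hr.1, h⟩⟩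
      rcases h.eq_or_lt with h' | h'
      · rw [h', hUp]; norm_num
      · linarith [hpos r ⟨hr.1.le, h'⟩]
    · obtain ⟨a1, a2, a3, a4⟩ := hafter r h hr.2
      exact ⟨a1, a2.le, a3.le, a4⟩
  have hsubS : Ioo R (p + ε) ⊆ S := fun r hr => (hall r hr).2.2.2
  have hsol := hU.mono hsubS
  refine ⟨p, p + ε, U, V, ⟨⟨hsol.contU, hsol.contV, hsol.value, hsol.slope, hsol.derivU,
    fun r hr => ?_⟩, hRp, by linarith, hUp, hpos, fun r hr => (hall r hr).1⟩, hsubS⟩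
  have h1 := hsol.derivV r hr
  have h2 : F (U r) = f (U r) := by
    simp only [F]
    rw [min_eq_left (hall r hr).2.2.1, max_eq_right (hall r hr).2.1]
  rwa [h2] at h1

theorem RightBranch.strictAntiOn {h f : ℝ → ℝ} {R M p q : ℝ} {U V : ℝ → ℝ}
    (hB : RightBranch h f R M p q U V) : StrictAntiOn U (Ico R q) := by
  have hRq := hB.lt_p.trans hB.lt_q
  refine strictAntiOn_of_deriv_neg (convex_Ico R q) (hB.sol.contU.mono ?_) fun r hr => ?_
  · intro r hr
    rcases hr.1.eq_or_lt with h | h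
    · exact Or.inl h.symm
    · exact Or.inr ⟨h, hr.2⟩
  · rw [interior_Ico] at hr
    rw [(hB.sol.derivU r hr).deriv]
    exact hB.slope_neg r hr

/-- The inverse function of the right branch. -/
theorem RightBranch.exists_inverse {h f : ℝ → ℝ} {R M p q : ℝ} {U V : ℝ → ℝ}
    (hB : RightBranch h f R M p q U V) :
    ∃ ρ : ℝ → ℝ, ContinuousOn ρ (Icc 0 M) ∧ ρ M = R ∧ ρ 0 = p ∧
      (∀ u ∈ Icc 0 M, ρ u ∈ Icc R p ∧ U (ρ u) = u) ∧
      ∀ u ∈ Ico 0 M, HasDerivAt ρ (V (ρ u))⁻¹ u := by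
  -- Inverting beyond `p` makes the height `0` interior to the range of `U`, so that the inverse has
  -- a two-sided derivative there.
  set c := (p + q) / 2 with hc
  have hpc : p < c := by linarith [hB.lt_q]
  have hcq : c < q := by linarith [hB.lt_q]
  have hRc : R < c := hB.lt_p.trans hpc
  have hsub : Icc R c ⊆ Ico R q := fun r hr => ⟨hr.1, hr.2.trans_lt hcq⟩
  have hanti : StrictAntiOn U (Icc R c) := hB.strictAntiOn.mono hsub
  have hcont : ContinuousOn U (Icc R c) := by
    refine hB.sol.contU.mono fun r hr => ?_
    rcases hr.1.eq_or_lt with h | h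
    · exact Or.inl h.symm
    · exact Or.inr ⟨h, hr.2.trans_lt hcq⟩
  have hUc : U c < 0 := by
    rw [← hB.zero]
    exact hanti ⟨hB.lt_p.le, hpc.le⟩ ⟨hRc.le, le_rfl⟩ hpc
  have hM : 0 < M := by rw [← hB.sol.value]; exact hB.pos R ⟨le_rfl, hB.lt_p⟩
  have hsurj : Icc (U c) M ⊆ U '' Icc R c := by
    have := intermediate_value_Icc' hRc.le hcont
    rwa [hB.sol.value] at this
  set ρ := Function.invFunOn U (Icc R c) with hρ
  have hmem : ∀ u ∈ Icc (U c) M, ρ u ∈ Icc R c := fun u hu =>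
    Function.invFunOn_mem (hsurj hu)
  have hright : ∀ u ∈ Icc (U c) M, U (ρ u) = u := fun u hu =>
    Function.invFunOn_eq (hsurj hu)
  have hleft : ∀ r ∈ Icc R c, ρ (U r) = r := fun r hr =>
    hanti.injOn.leftInvOn_invFunOn hr
  have hUmem : ∀ r ∈ Icc R c, U r ∈ Icc (U c) M := by
    intro r hr
    refine ⟨hanti.antitoneOn hr ⟨hRc.le, le_rfl⟩ hr.2, ?_⟩
    rw [← hB.sol.value]
    exact hanti.antitoneOn ⟨le_rfl, hRc.le⟩ hr hr.1
  have hρc : ContinuousOn ρ (Icc (U c) M) := by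
    rw [continuousOn_iff_isClosed]
    intro t ht
    refine ⟨U '' (Icc R c ∩ t), ((isCompact_Icc.inter_right ht).image_of_continuousOn
      (hcont.mono inter_subset_left)).isClosed, ?_⟩
    ext u
    constructor
    · rintro ⟨h1, h2⟩
      exact ⟨⟨ρ u, ⟨hmem u h2, h1⟩, hright u h2⟩, h2⟩
    · rintro ⟨⟨r, ⟨h1, h2⟩, rfl⟩, h3⟩
      refine ⟨?_, h3⟩
      rw [mem_preimage, hleft r h1]
      exact h2
  have hsubI : Icc 0 M ⊆ Icc (U c) M := Icc_subset_Icc_left hUc.le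
  have hρM : ρ M = R := by
    have := hleft R ⟨le_rfl, hRc.le⟩
    rwa [hB.sol.value] at this
  have hρ0 : ρ 0 = p := by
    have := hleft p ⟨hB.lt_p.le, hpc.le⟩
    rwa [hB.zero] at this
  refine ⟨ρ, hρc.mono hsubI, hρM, hρ0, fun u hu => ⟨⟨(hmem u (hsubI hu)).1, ?_⟩,
    hright u (hsubI hu)⟩, fun u hu => ?_⟩
  · by_contra hcon
    have h1 := hanti ⟨hB.lt_p.le, hpc.le⟩ (hmem u (hsubI hu)) (not_le.1 hcon)
    rw [hright u (hsubI hu), hB.zero] at h1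
    exact absurd hu.1 (not_le.2 h1)
  · have hu' : u ∈ Icc (U c) M := hsubI ⟨hu.1, hu.2.le⟩
    have hnhds : Icc (U c) M ∈ 𝓝 u := Icc_mem_nhds (hUc.trans_le hu.1) hu.2
    have hne : ρ u ≠ R := by
      intro h
      have := hright u hu'
      rw [h, hB.sol.value] at this
      exact hu.2.ne this.symm
    have hρu : ρ u ∈ Ioo R q :=
      ⟨lt_of_le_of_ne (hmem u hu').1 hne.symm, (hmem u hu').2.trans_lt hcq⟩
    refine HasDerivAt.of_local_left_inverse (hρc.continuousAt hnhds) (hB.sol.derivU _ hρu)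
      (hB.slope_neg _ hρu).ne ?_
    filter_upwards [hnhds] with x hx using hright x hx

/-! ### Comparison of two branches with different cores. -/

/-- Sturm comparison up to a first contact `t`. While `0 < U₁ < U₂`, the hypothesis `hfm`, which
says that `f(x)/x` is nonincreasing, makes `w (V₂ U₁ - U₂ V₁)` nondecreasing. At `R₂` it equals `-w
M V₁ > 0`. The Wronskian therefore stays positive and rules out contact. -/
theorem RightBranch.lt_of_lt {w h f : ℝ → ℝ} {R₁ R₂ M p₁ p₂ q₁ q₂ : ℝ} {S : Set ℝ}
    {U₁ V₁ U₂ V₂ : ℝ → ℝ} (hw : HalfWeight w h R₁ S) (hR : R₁ < R₂)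
    (h₁ : RightBranch h f R₁ M p₁ q₁ U₁ V₁) (h₂ : RightBranch h f R₂ M p₂ q₂ U₂ V₂)
    (hS₁ : Ioo R₁ q₁ ⊆ S)
    (hfm : ∀ x y, 0 < x → x ≤ y → y ≤ M → x * f y ≤ y * f x) :
    ∀ r, R₂ ≤ r → r ≤ p₁ → r ≤ p₂ → U₁ r < U₂ r := by
  intro r₀ hr₀ hrp₁ hrp₂
  by_contra! hcon
  have hM : 0 < M := by rw [← h₁.sol.value]; exact h₁.pos R₁ ⟨le_rfl, h₁.lt_p⟩
  have hsub₁ : Icc R₂ r₀ ⊆ Ioo R₁ q₁ := fun x hx =>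
    ⟨hR.trans_le hx.1, hx.2.trans_lt (hrp₁.trans_lt h₁.lt_q)⟩
  have hsub₂ : Icc R₂ r₀ ⊆ insert R₂ (Ioo R₂ q₂) := by
    intro x hx
    rcases hx.1.eq_or_lt with h | h
    · exact Or.inl h.symm
    · exact Or.inr ⟨h, hx.2.trans_lt (hrp₂.trans_lt h₂.lt_q)⟩
  have hc₁ : ContinuousOn U₁ (Icc R₂ r₀) := fun x hx =>
    (h₁.sol.derivU x (hsub₁ hx)).continuousAt.continuousWithinAt
  have hc₁' : ContinuousOn V₁ (Icc R₂ r₀) := fun x hx =>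
    (h₁.sol.derivV x (hsub₁ hx)).continuousAt.continuousWithinAt
  have hc₂ : ContinuousOn U₂ (Icc R₂ r₀) := h₂.sol.contU.mono hsub₂
  have hcomp : IsCompact {r ∈ Icc R₂ r₀ | U₂ r - U₁ r ≤ 0} :=
    isCompact_Icc.of_isClosed_subset
      ((hc₂.sub hc₁).preimage_isClosed_of_isClosed isClosed_Icc isClosed_Iic) (sep_subset _ _)
  obtain ⟨t, ⟨htI, ht0⟩, htmin⟩ := hcomp.exists_isLeast
    ⟨r₀, ⟨hr₀, le_rfl⟩, by simpa using hcon⟩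
  have hbefore : ∀ r ∈ Ico R₂ t, U₁ r < U₂ r := by
    intro r hr
    by_contra hc
    exact absurd (htmin ⟨⟨hr.1, hr.2.le.trans htI.2⟩, by linarith [not_lt.1 hc]⟩)
      (not_le.2 hr.2)
  have hR₂q : R₂ ∈ Ioo R₁ q₁ := hsub₁ ⟨le_rfl, hr₀⟩
  have hstart : U₁ R₂ < M := by
    rw [← h₁.sol.value]
    exact h₁.strictAntiOn ⟨le_rfl, hR.trans hR₂q.2⟩ ⟨hR.le, hR₂q.2⟩ hR
  have hRt : R₂ < t := by
    refine lt_of_le_of_ne htI.1 fun h => ?_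
    rw [← h, h₂.sol.value] at ht0
    linarith
  have hIt : Icc R₂ t ⊆ Icc R₂ r₀ := Icc_subset_Icc_right htI.2
  have hwS : ∀ r ∈ Icc R₂ t, 0 < w r ∧ HasDerivAt w (h r * w r) r := fun r hr =>
    ⟨hw.pos r (hS₁ (hsub₁ (hIt hr))), hw.deriv r (hS₁ (hsub₁ (hIt hr)))⟩
  have hpos₁ : ∀ r ∈ Ico R₂ t, 0 < U₁ r := fun r hr =>
    h₁.pos r ⟨(hR.trans_le hr.1).le, hr.2.trans_le (htI.2.trans hrp₁)⟩
  have hwt := (hwS t ⟨hRt.le, le_rfl⟩).1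
  have hmono : MonotoneOn (fun r => w r * (V₂ r * U₁ r - U₂ r * V₁ r)) (Icc R₂ t) := by
    have hder : ∀ r ∈ Ioo R₂ t, HasDerivAt (fun r => w r * (V₂ r * U₁ r - U₂ r * V₁ r))
        (w r * (U₂ r * f (U₁ r) - U₁ r * f (U₂ r))) r := by
      intro r hr
      have hr₁ := hsub₁ (hIt ⟨hr.1.le, hr.2.le⟩)
      have hr₂ : r ∈ Ioo R₂ q₂ := ⟨hr.1, hr.2.trans_le (htI.2.trans (hrp₂.trans h₂.lt_q.le))⟩
      refine ((hwS r ⟨hr.1.le, hr.2.le⟩).2.mul (((h₂.sol.derivV r hr₂).mul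
        (h₁.sol.derivU r hr₁)).sub ((h₂.sol.derivU r hr₂).mul
        (h₁.sol.derivV r hr₁)))).congr_deriv ?_
      simp only [Pi.sub_apply, Pi.mul_apply]
      ring
    refine monotoneOn_of_deriv_nonneg (convex_Icc _ _) ?_ ?_ ?_
    · exact ContinuousOn.mul (fun r hr => (hwS r hr).2.continuousAt.continuousWithinAt)
        ((((h₂.sol.contV.mono hsub₂).mono hIt).mul (hc₁.mono hIt)).sub
          ((hc₂.mono hIt).mul (hc₁'.mono hIt)))
    · rw [interior_Icc]
      exact fun r hr => (hder r hr).differentiableAt.differentiableWithinAt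
    · rw [interior_Icc]
      intro r hr
      rw [(hder r hr).deriv]
      have hr₂ : r ∈ Ico R₂ q₂ := ⟨hr.1.le, hr.2.trans_le (htI.2.trans (hrp₂.trans h₂.lt_q.le))⟩
      have hle : U₂ r ≤ M := by
        rw [← h₂.sol.value]
        exact h₂.strictAntiOn.antitoneOn ⟨le_rfl, h₂.lt_p.trans h₂.lt_q⟩ hr₂ hr₂.1
      have h3 := hfm (U₁ r) (U₂ r) (hpos₁ r ⟨hr.1.le, hr.2⟩) (hbefore r ⟨hr.1.le, hr.2⟩).le hle
      exact mul_nonneg (hwS r ⟨hr.1.le, hr.2.le⟩).1.le (by linarith)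
  have hWpos : ∀ r ∈ Icc R₂ t, 0 < V₂ r * U₁ r - U₂ r * V₁ r := by
    intro r hr
    have h4 := hmono ⟨le_rfl, hRt.le⟩ hr hr.1
    simp only [h₂.sol.slope, h₂.sol.value, zero_mul, zero_sub] at h4
    have h5 : 0 < w R₂ * -(M * V₁ R₂) := by
      have := mul_pos hM (neg_pos.2 (h₁.slope_neg R₂ hR₂q))
      exact mul_pos (hwS R₂ ⟨le_rfl, hRt.le⟩).1 (by linarith)
    exact pos_of_mul_pos_right (h5.trans_le h4) (hwS r hr).1.le
  have hU₁t : 0 ≤ U₁ t := by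
    rcases (htI.2.trans hrp₁).eq_or_lt with h | h
    · rw [h, h₁.zero]
    · exact (h₁.pos t ⟨(hR.trans hRt).le, h⟩).le
  have hU₂t : 0 ≤ U₂ t := by
    rcases (htI.2.trans hrp₂).eq_or_lt with h | h
    · rw [h, h₂.zero]
    · exact (h₂.pos t ⟨hRt.le, h⟩).le
  have ht0' : U₂ t ≤ U₁ t := by linarith
  rcases hU₁t.eq_or_lt with hz | hz
  -- Contact at height zero would make the Wronskian vanish.
  · have h6 : U₂ t = 0 := by linarith
    have h7 := hWpos t ⟨hRt.le, le_rfl⟩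
    rw [← hz, h6] at h7
    simp at h7
  · have hpos₁' : ∀ r ∈ Icc R₂ t, 0 < U₁ r := by
      intro r hr
      rcases hr.2.eq_or_lt with h | h
      · rw [h]; exact hz
      · exact hpos₁ r ⟨hr.1, h⟩
    -- Contact at positive height is excluded by the quotient, whose derivative is the Wronskian
    -- over `U₁²`: it starts above `1` and increases.
    have hq : StrictMonoOn (fun r => U₂ r / U₁ r) (Icc R₂ t) := by
      refine strictMonoOn_of_deriv_pos (convex_Icc _ _)
        ((hc₂.mono hIt).div (hc₁.mono hIt) fun r hr => (hpos₁' r hr).ne') fun r hr => ?_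
      rw [interior_Icc] at hr
      have hr' : r ∈ Icc R₂ t := ⟨hr.1.le, hr.2.le⟩
      have hr₂ : r ∈ Ioo R₂ q₂ := ⟨hr.1, hr.2.trans_le (htI.2.trans (hrp₂.trans h₂.lt_q.le))⟩
      have hder : HasDerivAt (fun r => U₂ r / U₁ r) _ r := (h₂.sol.derivU r hr₂).div
        (h₁.sol.derivU r (hsub₁ (hIt hr'))) (hpos₁' r hr').ne'
      rw [hder.deriv]
      exact div_pos (hWpos r hr') (pow_pos (hpos₁' r hr') 2)
    have h8 := hq ⟨le_rfl, hRt.le⟩ ⟨hRt.le, le_rfl⟩ hRt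
    simp only [h₂.sol.value] at h8
    have h9 : U₂ t / U₁ t ≤ 1 := (div_le_one hz).2 ht0'
    have h10 : 1 < M / U₁ R₂ := (one_lt_div (hpos₁' R₂ ⟨le_rfl, hRt.le⟩)).2 hstart
    linarith

/-- The height `u` serves as a common variable. The slope difference `d(u) = V₁(ρ₁(u)) - V₂(ρ₂(u))`
satisfies `d' = h(ρ₂) - h(ρ₁) - f(u) (1/V₁ - 1/V₂)`, and this is negative wherever `d ≤ 0`. If `d(0)
≤ 0`, then `d` would decrease strictly from there to `d(M) = 0`, which is impossible. -/
theorem RightBranch.slope_lt_of_lt {w h f : ℝ → ℝ} {R₁ R₂ M p₁ p₂ q₁ q₂ : ℝ} {S : Set ℝ}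
    {U₁ V₁ U₂ V₂ : ℝ → ℝ} (hw : HalfWeight w h R₁ S) (hR : R₁ < R₂)
    (h₁ : RightBranch h f R₁ M p₁ q₁ U₁ V₁) (h₂ : RightBranch h f R₂ M p₂ q₂ U₂ V₂)
    (hS₁ : Ioo R₁ q₁ ⊆ S) (hS₂ : Ioo R₂ q₂ ⊆ S) (hf0 : ∀ x ∈ Ico 0 M, 0 ≤ f x)
    (hfm : ∀ x y, 0 < x → x ≤ y → y ≤ M → x * f y ≤ y * f x) : V₂ p₂ < V₁ p₁ := by
  have hM : 0 < M := by rw [← h₁.sol.value]; exact h₁.pos R₁ ⟨le_rfl, h₁.lt_p⟩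
  obtain ⟨ρ₁, hc₁, hρM₁, hρ0₁, hρ₁, hd₁⟩ := h₁.exists_inverse
  obtain ⟨ρ₂, hc₂, hρM₂, hρ0₂, hρ₂, hd₂⟩ := h₂.exists_inverse
  have hmem : ∀ {R p q : ℝ} {ρ U V : ℝ → ℝ}, RightBranch h f R M p q U V →
      (∀ u ∈ Icc 0 M, ρ u ∈ Icc R p ∧ U (ρ u) = u) → ∀ u ∈ Ico 0 M, ρ u ∈ Ioo R q := by
    intro R p q ρ U V hB hρ u hu
    obtain ⟨h1, h2⟩ := hρ u ⟨hu.1, hu.2.le⟩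
    refine ⟨lt_of_le_of_ne h1.1 fun h => ?_, h1.2.trans_lt hB.lt_q⟩
    rw [← h, hB.sol.value] at h2
    exact hu.2.ne h2.symm
  have hmem₁ := hmem h₁ hρ₁
  have hmem₂ := hmem h₂ hρ₂
  -- When `ρ₁ u ≤ R₂` there is nothing to compare; otherwise the ordering of the graphs at the
  -- radius `ρ₂ u` contradicts the monotonicity of `U₁`.
  have horder : ∀ u ∈ Ico 0 M, ρ₁ u < ρ₂ u := by
    intro u hu
    have hu' : u ∈ Icc 0 M := ⟨hu.1, hu.2.le⟩
    rcases le_or_gt (ρ₁ u) R₂ with hle | hgt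
    · exact hle.trans_lt (hmem₂ u hu).1
    · by_contra! hcon
      have h3 := RightBranch.lt_of_lt hw hR h₁ h₂ hS₁ hfm (ρ₂ u) (hmem₂ u hu).1.le
        (hcon.trans (hρ₁ u hu').1.2) (hρ₂ u hu').1.2
      have h4 := h₁.strictAntiOn.antitoneOn
        ⟨(hR.trans (hmem₂ u hu).1).le, hcon.trans_lt (hmem₁ u hu).2⟩
        ⟨(hmem₁ u hu).1.le, (hmem₁ u hu).2⟩ hcon
      rw [(hρ₁ u hu').2] at h4
      rw [(hρ₂ u hu').2] at h3
      linarith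
  have hcV : ∀ {R p q : ℝ} {ρ U V : ℝ → ℝ}, RightBranch h f R M p q U V →
      ContinuousOn ρ (Icc 0 M) → (∀ u ∈ Icc 0 M, ρ u ∈ Icc R p ∧ U (ρ u) = u) →
      ContinuousOn (fun u => V (ρ u)) (Icc 0 M) := by
    intro R p q ρ U V hB hc hρ
    refine hB.sol.contV.comp hc fun u hu => ?_
    rcases (hρ u hu).1.1.eq_or_lt with h | h
    · exact Or.inl h.symm
    · exact Or.inr ⟨h, (hρ u hu).1.2.trans_lt hB.lt_q⟩
  let d : ℝ → ℝ := fun u => V₁ (ρ₁ u) - V₂ (ρ₂ u)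
  let d' : ℝ → ℝ := fun u => (-(h (ρ₁ u) * V₁ (ρ₁ u)) - f (U₁ (ρ₁ u))) * (V₁ (ρ₁ u))⁻¹ -
    (-(h (ρ₂ u) * V₂ (ρ₂ u)) - f (U₂ (ρ₂ u))) * (V₂ (ρ₂ u))⁻¹
  have hdc : ContinuousOn d (Icc 0 M) := (hcV h₁ hc₁ hρ₁).sub (hcV h₂ hc₂ hρ₂)
  have hdd : ∀ u ∈ Ico 0 M, HasDerivAt d (d' u) u := by
    intro u hu
    have e1 : HasDerivAt (fun u => V₁ (ρ₁ u)) _ u :=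
      (h₁.sol.derivV _ (hmem₁ u hu)).comp u (hd₁ u hu)
    have e2 : HasDerivAt (fun u => V₂ (ρ₂ u)) _ u :=
      (h₂.sol.derivV _ (hmem₂ u hu)).comp u (hd₂ u hu)
    exact e1.sub e2
  have hneg : ∀ u ∈ Ico 0 M, d u ≤ 0 → d' u < 0 := by
    intro u hu hdu
    have hu' : u ∈ Icc 0 M := ⟨hu.1, hu.2.le⟩
    have hV₁ := h₁.slope_neg _ (hmem₁ u hu)
    have hV₂ := h₂.slope_neg _ (hmem₂ u hu)
    have e1 : d' u = h (ρ₂ u) - h (ρ₁ u) - f u * ((V₁ (ρ₁ u))⁻¹ - (V₂ (ρ₂ u))⁻¹) := by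
      simp only [d', (hρ₁ u hu').2, (hρ₂ u hu').2]
      have n1 := hV₁.ne
      have n2 := hV₂.ne
      field_simp
      ring
    have e2 : (V₂ (ρ₂ u))⁻¹ ≤ (V₁ (ρ₁ u))⁻¹ := by
      rw [inv_le_inv_of_neg hV₂ hV₁]
      simp only [d] at hdu
      linarith
    have e3 : h (ρ₂ u) < h (ρ₁ u) :=
      hw.anti (hS₁ (hmem₁ u hu)) (hS₂ (hmem₂ u hu)) (horder u hu)
    rw [e1]
    have e4 := mul_nonneg (hf0 u hu) (sub_nonneg.2 e2)
    linarith
  have hdM : d M = 0 := by simp [d, hρM₁, hρM₂, h₁.sol.slope, h₂.sol.slope]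
  have hd0 : 0 < d 0 := by
    by_contra! hcon
    have hle : ∀ u ∈ Icc 0 M, d u ≤ 0 := by
      intro u hu
      refine image_le_of_deriv_right_lt_deriv_boundary (f := d) (f' := d') (B := fun _ => 0)
        (B' := fun _ => 0) hdc (fun x hx => (hdd x hx).hasDerivWithinAt) hcon
        (fun x => hasDerivAt_const x _) (fun x hx hx0 => hneg x hx hx0.le) hu
    have hst : StrictAntiOn d (Icc 0 M) := by
      refine strictAntiOn_of_deriv_neg (convex_Icc _ _) hdc fun u hu => ?_
      rw [interior_Icc] at hu
      rw [(hdd u ⟨hu.1.le, hu.2⟩).deriv]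
      exact hneg u ⟨hu.1.le, hu.2⟩ (hle u ⟨hu.1.le, hu.2.le⟩)
    have := hst ⟨le_rfl, hM.le⟩ ⟨hM.le, le_rfl⟩ hM
    linarith
  simp only [d, hρ0₁, hρ0₂] at hd0
  linarith

/-! ### The model functions, and the weights on the two sides of the core. -/

/-- The derivative of `sk k`. -/
noncomputable def ck (k r : ℝ) : ℝ :=
  if k < 0 then Real.cosh (Real.sqrt (-k) * r)
  else if k = 0 then 1
  else Real.cos (Real.sqrt k * r)

theorem hasDerivAt_sk (k r : ℝ) : HasDerivAt (sk k) (ck k r) r := by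
  rcases lt_trichotomy k 0 with hk | hk | hk
  · have hs : sk k = fun r => Real.sinh (Real.sqrt (-k) * r) / Real.sqrt (-k) := by
      funext r; simp [sk, hk]
    have h0 : Real.sqrt (-k) ≠ 0 := (Real.sqrt_pos.2 (by linarith)).ne'
    rw [hs, ck, if_pos hk]
    refine ((((hasDerivAt_id r).const_mul (Real.sqrt (-k))).sinh).div_const _).congr_deriv ?_
    simp only [id]
    field_simp
  · have hs : sk k = fun r => r := by funext r; simp [sk, hk]
    rw [hs, ck, if_neg (by linarith), if_pos hk]
    exact hasDerivAt_id r
  · have hs : sk k = fun r => Real.sin (Real.sqrt k * r) / Real.sqrt k := by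
      funext r; simp [sk, hk.not_gt, hk.ne']
    have h0 : Real.sqrt k ≠ 0 := (Real.sqrt_pos.2 hk).ne'
    rw [hs, ck, if_neg hk.not_gt, if_neg hk.ne']
    refine ((((hasDerivAt_id r).const_mul (Real.sqrt k)).sin).div_const _).congr_deriv ?_
    simp only [id]
    field_simp

theorem hasDerivAt_ck (k r : ℝ) : HasDerivAt (ck k) (-k * sk k r) r := by
  rcases lt_trichotomy k 0 with hk | hk | hk
  · have hs : ck k = fun r => Real.cosh (Real.sqrt (-k) * r) := by
      funext r; simp [ck, hk]
    have h0 : Real.sqrt (-k) ≠ 0 := (Real.sqrt_pos.2 (by linarith)).ne'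
    have h1 : Real.sqrt (-k) ^ 2 = -k := Real.sq_sqrt (by linarith)
    rw [hs, sk, if_pos hk]
    refine (((hasDerivAt_id r).const_mul (Real.sqrt (-k))).cosh).congr_deriv ?_
    simp only [id]
    field_simp
    linear_combination h1 * Real.sinh (Real.sqrt (-k) * r)
  · have hs : ck k = fun _ => 1 := by funext r; simp [ck, hk]
    rw [hs, hk]
    simpa using hasDerivAt_const r (1 : ℝ)
  · have hs : ck k = fun r => Real.cos (Real.sqrt k * r) := by
      funext r; simp [ck, hk.not_gt, hk.ne']
    have h0 : Real.sqrt k ≠ 0 := (Real.sqrt_pos.2 hk).ne'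
    have h1 : Real.sqrt k ^ 2 = k := Real.sq_sqrt hk.le
    rw [hs, sk, if_neg hk.not_gt, if_neg hk.ne']
    refine (((hasDerivAt_id r).const_mul (Real.sqrt k)).cos).congr_deriv ?_
    simp only [id]
    nth_rewrite 3 [← h1]
    field_simp

theorem sk_zero (k : ℝ) : sk k 0 = 0 := by simp [sk]

theorem ck_zero (k : ℝ) : ck k 0 = 1 := by simp [ck]

/-- The left side has zero derivative and equals `1` at `r = 0`. This first integral is what gives
`cot_k' = -1 / s_k²` without splitting on the sign of `k`. -/
theorem ck_sq_add (k r : ℝ) : ck k r ^ 2 + k * sk k r ^ 2 = 1 := by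
  have hd : ∀ x, HasDerivAt (fun r => ck k r ^ 2 + k * sk k r ^ 2) 0 x := by
    intro x
    refine (((hasDerivAt_ck k x).pow 2).add (((hasDerivAt_sk k x).pow 2).const_mul k)).congr_deriv ?_
    simp
    ring
  have := is_const_of_deriv_eq_zero (fun x => (hd x).differentiableAt) (fun x => (hd x).deriv) r 0
  simpa [sk_zero, ck_zero] using this

theorem mem_openBaseInterval {k r : ℝ} :
    r ∈ openBaseInterval k ↔ 0 < r ∧ (k ≤ 0 ∨ r < Real.pi / Real.sqrt k) := by
  unfold openBaseInterval rBar
  by_cases hk : k ≤ 0 <;> simp [hk]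

theorem zero_mem_baseInterval (k : ℝ) : (0 : ℝ) ∈ baseInterval k := by
  refine ⟨le_rfl, ?_⟩
  unfold rBar
  split_ifs with hk
  · exact EReal.coe_lt_top 0
  · have := Real.pi_pos
    have := Real.sqrt_pos.2 (not_le.1 hk)
    exact EReal.coe_lt_coe_iff.2 (by positivity)

theorem isOpen_openBaseInterval (k : ℝ) : IsOpen (openBaseInterval k) := by
  have : openBaseInterval k = Ioi 0 ∩ (fun r : ℝ => (r : EReal)) ⁻¹' Iio (rBar k) := rfl
  rw [this]
  exact isOpen_Ioi.inter (isOpen_Iio.preimage continuous_coe_real_ereal)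

theorem baseInterval_mem_of_le {k r s : ℝ} (hr : r ∈ baseInterval k) (hs : 0 ≤ s) (hsr : s ≤ r) :
    s ∈ baseInterval k := ⟨hs, (EReal.coe_le_coe_iff.2 hsr).trans_lt hr.2⟩

theorem openBaseInterval_mem_of_le {k r s : ℝ} (hr : r ∈ baseInterval k) (hs : 0 < s)
    (hsr : s ≤ r) : s ∈ openBaseInterval k := ⟨hs, (EReal.coe_le_coe_iff.2 hsr).trans_lt hr.2⟩

theorem openBaseInterval_subset (k : ℝ) : openBaseInterval k ⊆ baseInterval k :=
  fun _ hr => ⟨hr.1.le, hr.2⟩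

theorem sk_pos {k r : ℝ} (hr : r ∈ openBaseInterval k) : 0 < sk k r := by
  obtain ⟨h0, h1⟩ := mem_openBaseInterval.1 hr
  unfold sk
  split_ifs with hk hk'
  · have : 0 < Real.sqrt (-k) := Real.sqrt_pos.2 (by linarith)
    exact div_pos (Real.sinh_pos_iff.2 (by positivity)) this
  · exact h0
  · have hk0 : 0 < k := lt_of_le_of_ne (not_lt.1 hk) (Ne.symm hk')
    have : 0 < Real.sqrt k := Real.sqrt_pos.2 hk0
    refine div_pos (Real.sin_pos_of_pos_of_lt_pi (by positivity) ?_) this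
    rw [mul_comm]
    exact (lt_div_iff₀ this).1 (h1.resolve_left (not_le.2 hk0))

theorem sk_pi_div_sqrt {k : ℝ} (hk : 0 < k) : sk k (Real.pi / Real.sqrt k) = 0 := by
  have : Real.sqrt k ≠ 0 := (Real.sqrt_pos.2 hk).ne'
  rw [sk, if_neg hk.not_gt, if_neg hk.ne', mul_div_cancel₀ _ this]
  simp

theorem cotk_eq (k r : ℝ) : cotk k r = ck k r / sk k r := by
  rw [cotk, (hasDerivAt_sk k r).deriv]

theorem hasDerivAt_cotk {k r : ℝ} (hr : r ∈ openBaseInterval k) :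
    HasDerivAt (cotk k) (-1 / sk k r ^ 2) r := by
  have hs := (sk_pos hr).ne'
  have : cotk k = fun r => ck k r / sk k r := funext (cotk_eq k)
  rw [this]
  refine ((hasDerivAt_ck k r).div (hasDerivAt_sk k r) hs).congr_deriv ?_
  congr 1
  linarith [ck_sq_add k r]

theorem ordConnected_openBaseInterval (k : ℝ) : (openBaseInterval k).OrdConnected :=
  ⟨fun _ hx _ hy _ hz => openBaseInterval_mem_of_le (openBaseInterval_subset k hy)
    (hx.1.trans_le hz.1) hz.2⟩

theorem cotk_strictAntiOn (k : ℝ) : StrictAntiOn (cotk k) (openBaseInterval k) := by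
  refine strictAntiOn_of_deriv_neg (ordConnected_openBaseInterval k).convex
    (fun r hr => (hasDerivAt_cotk hr).continuousAt.continuousWithinAt) fun r hr => ?_
  have hr' := interior_subset hr
  rw [(hasDerivAt_cotk hr').deriv]
  exact div_neg_of_neg_of_pos (by norm_num) (pow_pos (sk_pos hr') 2)

/-- The area density `s_k ^ (n - 1)`. -/
noncomputable def area (n : ℕ) (k r : ℝ) : ℝ := sk k r ^ (n - 1)

/-- The mean curvature `(n - 1) cot_k`. -/
noncomputable def curv (n : ℕ) (k r : ℝ) : ℝ := ((n : ℝ) - 1) * cotk k r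

theorem area_pos {n : ℕ} {k r : ℝ} (hr : r ∈ openBaseInterval k) : 0 < area n k r :=
  pow_pos (sk_pos hr) _

theorem continuous_area (n : ℕ) (k : ℝ) : Continuous (area n k) :=
  (continuous_iff_continuousAt.2 fun r => (hasDerivAt_sk k r).continuousAt).pow _

theorem hasDerivAt_area {n : ℕ} (hn : 2 ≤ n) {k r : ℝ} (hr : r ∈ openBaseInterval k) :
    HasDerivAt (area n k) (curv n k r * area n k r) r := by
  obtain ⟨m, rfl⟩ : ∃ m, n = m + 2 := ⟨n - 2, by omega⟩
  have hs := (sk_pos hr).ne'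
  refine ((hasDerivAt_sk k r).pow (m + 1)).congr_deriv ?_
  simp only [curv, area, cotk_eq]
  push_cast
  rw [pow_succ]
  field_simp
  ring

theorem curv_strictAntiOn {n : ℕ} (hn : 2 ≤ n) (k : ℝ) :
    StrictAntiOn (curv n k) (openBaseInterval k) := by
  intro a ha b hb hab
  have : (2 : ℝ) ≤ n := by exact_mod_cast hn
  exact mul_lt_mul_of_pos_left (cotk_strictAntiOn k ha hb hab) (by linarith)

/-- One factor of `s_k` vanishes at least linearly at `e`, and the other `n - 2` factors are
bounded. This supplies the weight bound for the finite-end argument at `π / √k` on the right and at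
`0` on the left. -/
theorem exists_area_le {n : ℕ} (hn : 2 ≤ n) {k a b e : ℝ} (he : e ∈ Icc a b) (hsk : sk k e = 0) :
    ∃ K, 0 < K ∧ ∀ r ∈ Icc a b, area n k r ≤ K * |r - e| := by
  obtain ⟨m, rfl⟩ : ∃ m, n = m + 2 := ⟨n - 2, by omega⟩
  have hckc : Continuous (ck k) :=
    continuous_iff_continuousAt.2 fun r => (hasDerivAt_ck k r).continuousAt
  obtain ⟨D, hD⟩ := isCompact_Icc.exists_bound_of_continuousOn (hckc.continuousOn (s := Icc a b))
  have hD0 : 0 ≤ D := (norm_nonneg _).trans (hD e he)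
  have hsk' : ∀ r ∈ Icc a b, |sk k r| ≤ D * |r - e| := by
    intro r hr
    have := Convex.norm_image_sub_le_of_norm_hasDerivWithin_le (f := sk k) (f' := ck k)
      (fun x _ => (hasDerivAt_sk k x).hasDerivWithinAt) hD (convex_Icc a b) he hr
    simpa [hsk] using this
  refine ⟨(D * (b - a)) ^ m * D + 1, ?_, fun r hr => ?_⟩
  · have : 0 ≤ b - a := by linarith [he.1, he.2]
    positivity
  · have h1 := hsk' r hr
    have hre : |r - e| ≤ b - a := by
      rw [abs_le]; constructor <;> linarith [hr.1, hr.2, he.1, he.2]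
    have h2 : |sk k r| ≤ D * (b - a) := h1.trans (mul_le_mul_of_nonneg_left hre hD0)
    have h3 : area (m + 2) k r ≤ |sk k r| ^ m * |sk k r| := by
      rw [area, show m + 2 - 1 = m + 1 by omega, ← pow_succ, ← abs_pow]
      exact le_abs_self _
    have h4 : |sk k r| ^ m * |sk k r| ≤ (D * (b - a)) ^ m * (D * |r - e|) :=
      mul_le_mul (pow_le_pow_left₀ (abs_nonneg _) h2 m) h1 (abs_nonneg _)
        (pow_nonneg ((abs_nonneg _).trans h2) m)
    have := abs_nonneg (r - e)
    linarith

theorem halfDomain_right (k R : ℝ) (hR : 0 ≤ R) : HalfDomain R (openBaseInterval k ∩ Ioi R) :=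
  ⟨(isOpen_openBaseInterval k).inter isOpen_Ioi, fun _ hr => hr.2, fun _ hr _ hx =>
    ⟨openBaseInterval_mem_of_le (openBaseInterval_subset k hr.1) (hR.trans_lt hx.1) hx.2, hx.1⟩⟩

theorem halfWeight_right {n : ℕ} (hn : 2 ≤ n) (k R : ℝ) :
    HalfWeight (area n k) (curv n k) R (openBaseInterval k ∩ Ioi R) :=
  ⟨(continuous_area n k).continuousWithinAt, fun _ hr => area_pos hr.1,
    fun _ hr => hasDerivAt_area hn hr.1, (curv_strictAntiOn hn k).mono inter_subset_left⟩

theorem neg_mem_openBaseInterval {k R r : ℝ} (hR : R ∈ openBaseInterval k) (hr : r ∈ Ioo (-R) 0) :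
    -r ∈ openBaseInterval k :=
  openBaseInterval_mem_of_le (openBaseInterval_subset k hR) (by linarith [hr.2]) (by linarith [hr.1])

/-- Reflection reverses the order and also changes the sign of the logarithmic derivative, so strict
decrease survives. -/
theorem halfWeight_left {n : ℕ} (hn : 2 ≤ n) {k R : ℝ} (hR : R ∈ openBaseInterval k) :
    HalfWeight (fun r => area n k (-r)) (fun r => -curv n k (-r)) (-R) (Ioo (-R) 0) := by
  refine ⟨((continuous_area n k).comp continuous_neg).continuousWithinAt,
    fun r hr => area_pos (neg_mem_openBaseInterval hR hr), fun r hr => ?_, fun a ha b hb hab => ?_⟩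
  · have := (hasDerivAt_area hn (neg_mem_openBaseInterval hR hr)).scomp r (hasDerivAt_neg r)
    refine this.congr_deriv ?_
    simp
  · have := curv_strictAntiOn hn k (neg_mem_openBaseInterval hR hb)
      (neg_mem_openBaseInterval hR ha) (neg_lt_neg hab)
    simpa using this

theorem exists_rightBranch_right {n : ℕ} (hn : 2 ≤ n) {k R M : ℝ} {f : ℝ → ℝ}
    (hR : R ∈ baseInterval k) (hf : BoundedLipschitz f) (hM : 0 < M)
    (hfpos : ∀ x ∈ Ioc 0 M, 0 < f x)
    (hfm : k ≤ 0 → ∃ m, 0 < m ∧ ∀ x ∈ Ioc 0 M, m ≤ f x) :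
    ∃ p q U V, RightBranch (curv n k) f R M p q U V ∧ Ioo R q ⊆ openBaseInterval k ∩ Ioi R := by
  refine exists_rightBranch (halfDomain_right k R hR.1) (halfWeight_right hn k R) hf hM hfpos ?_
  rcases le_or_gt k 0 with hk | hk
  · refine Or.inr ⟨?_, hfm hk⟩
    ext r
    simp only [mem_inter_iff, mem_openBaseInterval, hk, true_or, and_true, mem_Ioi]
    exact ⟨fun h => h.2, fun h => ⟨hR.1.trans_lt h, h⟩⟩
  · set e := Real.pi / Real.sqrt k with he
    have hRe : R < e := by
      have := hR.2
      rw [rBar, if_neg (not_le.2 hk)] at this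
      exact EReal.coe_lt_coe_iff.1 this
    have hS : openBaseInterval k ∩ Ioi R = Ioo R e := by
      ext r
      simp only [mem_inter_iff, mem_openBaseInterval, not_le.2 hk, false_or, mem_Ioi, mem_Ioo]
      exact ⟨fun h => ⟨h.2, h.1.2⟩, fun h => ⟨⟨hR.1.trans_lt h.1, h.2⟩, h.1⟩⟩
    obtain ⟨K, hK, hKr⟩ := exists_area_le hn (k := k) (right_mem_Icc.2 hRe.le) (sk_pi_div_sqrt hk)
    refine Or.inl ⟨K, e, hK, hRe, hS, fun r hr => ?_⟩
    rw [hS] at hr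
    have := hKr r ⟨hr.1.le, hr.2.le⟩
    rwa [abs_sub_comm, abs_of_pos (by linarith [hr.2])] at this

/-- Towards the origin the interval always ends at a zero of the weight, so the logarithmic argument
applies for every `k` and no lower bound on `f` is needed. -/
theorem exists_rightBranch_left {n : ℕ} (hn : 2 ≤ n) {k R M : ℝ} {f : ℝ → ℝ}
    (hR : R ∈ openBaseInterval k) (hf : BoundedLipschitz f) (hM : 0 < M)
    (hfpos : ∀ x ∈ Ioc 0 M, 0 < f x) :
    ∃ p q U V, RightBranch (fun r => -curv n k (-r)) f (-R) M p q U V ∧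
      Ioo (-R) q ⊆ Ioo (-R) 0 := by
  have hR0 : 0 < R := hR.1
  refine exists_rightBranch HalfDomain.Ioo (halfWeight_left hn hR) hf hM hfpos ?_
  obtain ⟨K, hK, hKr⟩ := exists_area_le hn (k := k) (left_mem_Icc.2 hR0.le) (sk_zero k)
  refine Or.inl ⟨K, 0, hK, by linarith, rfl, fun r hr => ?_⟩
  have := hKr (-r) ⟨by linarith [hr.2], by linarith [hr.1]⟩
  simp only [zero_sub]
  rwa [sub_zero, abs_of_pos (by linarith [hr.2])] at this

/-! ### Gluing branches into solutions of the radial equation. -/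

theorem HalfDomain.mem_nhdsGT {R b : ℝ} {S : Set ℝ} (hS : HalfDomain R S) (hb : b ∈ S) :
    S ∈ 𝓝[>] R :=
  mem_of_superset (Ioc_mem_nhdsGT (hS.lt b hb)) (hS.Ioc_subset b hb)

theorem HalfSolution.hasDerivWithinAt {h F : ℝ → ℝ} {R M b : ℝ} {S : Set ℝ} {U V : ℝ → ℝ}
    (hS : HalfDomain R S) (hU : HalfSolution h F R M S U V) (hb : b ∈ S) :
    HasDerivWithinAt U 0 (Ici R) R := by
  have hmem := hS.mem_nhdsGT hb
  refine hasDerivWithinAt_Ici_of_tendsto_deriv (s := S)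
    (fun r hr => (hU.derivU r hr).differentiableAt.differentiableWithinAt)
    ((hU.contU R (mem_insert _ _)).mono (subset_insert _ _)) hmem ?_
  have h1 : Tendsto V (𝓝[S] R) (𝓝 0) := by
    rw [← hU.slope]
    exact (hU.contV R (mem_insert _ _)).mono (subset_insert _ _)
  refine (h1.mono_left (nhdsWithin_le_of_mem hmem)).congr' ?_
  filter_upwards [hmem] with r hr using (hU.derivU r hr).deriv.symm

/-- The derivative of `V` has a limit at `R`, where the damping term vanishes with `V`. The limit
depends only on `M`, so the two sides of a positive core agree to second order. -/
theorem HalfSolution.hasDerivWithinAt_slope {h F : ℝ → ℝ} {R M b : ℝ} {S : Set ℝ} {U V : ℝ → ℝ}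
    (hS : HalfDomain R S) (hU : HalfSolution h F R M S U V) (hb : b ∈ S)
    (hh : ContinuousAt h R) (hF : Continuous F) :
    HasDerivWithinAt V (-F M) (Ici R) R := by
  have hmem := hS.mem_nhdsGT hb
  refine hasDerivWithinAt_Ici_of_tendsto_deriv (s := S)
    (fun r hr => (hU.derivV r hr).differentiableAt.differentiableWithinAt)
    ((hU.contV R (mem_insert _ _)).mono (subset_insert _ _)) hmem ?_
  have h1 : Tendsto (fun r => -(h r * V r) - F (U r)) (𝓝[S] R) (𝓝 (-(h R * V R) - F (U R))) := by
    have hc : ContinuousWithinAt (fun r => -(h r * V r) - F (U r)) S R :=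
      (hh.continuousWithinAt.mul ((hU.contV R (mem_insert _ _)).mono (subset_insert _ _))).neg.sub
        (hF.continuousAt.comp_continuousWithinAt
          ((hU.contU R (mem_insert _ _)).mono (subset_insert _ _)))
    exact hc
  rw [hU.slope, hU.value, mul_zero, neg_zero, zero_sub] at h1
  refine (h1.mono_left (nhdsWithin_le_of_mem hmem)).congr' ?_
  filter_upwards [hmem] with r hr using (hU.derivV r hr).deriv.symm

theorem RightBranch.congr {h f : ℝ → ℝ} {R M p q : ℝ} {U V U' : ℝ → ℝ}
    (hB : RightBranch h f R M p q U V) (hU : EqOn U' U (Ico R q)) :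
    RightBranch h f R M p q U' V := by
  have hRq := hB.lt_p.trans hB.lt_q
  have hins : insert R (Ioo R q) = Ico R q := Ioo_insert_left hRq
  refine ⟨⟨?_, hB.sol.contV, ?_, hB.sol.slope, fun r hr => ?_, fun r hr => ?_⟩, hB.lt_p, hB.lt_q,
    ?_, fun r hr => ?_, hB.slope_neg⟩
  · have := hB.sol.contU
    rw [hins] at this ⊢
    exact this.congr hU
  · rw [hU ⟨le_rfl, hRq⟩, hB.sol.value]
  · refine (hB.sol.derivU r hr).congr_of_eventuallyEq ?_
    filter_upwards [isOpen_Ioo.mem_nhds hr] with x hx using hU ⟨hx.1.le, hx.2⟩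
  · rw [hU ⟨hr.1.le, hr.2⟩]
    exact hB.sol.derivV r hr
  · rw [hU ⟨hB.lt_p.le, hB.lt_q⟩, hB.zero]
  · rw [hU ⟨hr.1, hr.2.trans hB.lt_q⟩]
    exact hB.pos r hr

theorem curv_continuousAt {n : ℕ} {k r : ℝ} (hr : r ∈ openBaseInterval k) :
    ContinuousAt (curv n k) r :=
  (hasDerivAt_cotk hr).continuousAt.const_mul _

theorem isRadialSolution_zero {n : ℕ} {k M p q : ℝ} {f U V : ℝ → ℝ}
    (hB : RightBranch (curv n k) f 0 M p q U V) (hq : Ioo 0 q ⊆ openBaseInterval k) :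
    IsRadialSolution n k f 0 M (Ico 0 q) U := by
  have hq0 := hB.lt_p.trans hB.lt_q
  have hins : insert 0 (Ioo 0 q) = Ico 0 q := Ioo_insert_left hq0
  have hmem : ∀ r ∈ Ico 0 q, 0 < r → r ∈ Ioo 0 q := fun r hr h => ⟨h, hr.2⟩
  refine ⟨⟨Iio q, isOpen_Iio, ?_⟩, ordConnected_Ico, ⟨le_rfl, hq0⟩, ?_, fun r hr h0 =>
    (hB.sol.derivU r (hmem r hr h0)).differentiableAt, fun r hr h0 => ?_, hB.sol.value, ?_⟩
  · ext r
    constructor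
    · intro hr
      refine ⟨hr.2, ?_⟩
      rcases hr.1.eq_or_lt with h | h
      · rw [← h]; exact zero_mem_baseInterval k
      · exact openBaseInterval_subset k (hq ⟨h, hr.2⟩)
    · exact fun hr => ⟨hr.2.1, hr.1⟩
  · rw [← hins]; exact hB.sol.contU
  · have hr' := hmem r hr h0
    rw [(hB.sol.derivU r hr').deriv]
    refine (hB.sol.derivV r hr').congr_of_eventuallyEq ?_
    filter_upwards [isOpen_Ioo.mem_nhds hr'] with x hx using (hB.sol.derivU x hx).deriv
  · exact (hB.sol.hasDerivWithinAt HalfDomain.Ioo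
      (show q / 2 ∈ Ioo 0 q from ⟨by linarith, by linarith⟩)).mono fun x hx => hx.1

theorem exists_isRadialSolution_pos {n : ℕ} {k R M p q p' q' : ℝ} {f U V U' V' : ℝ → ℝ}
    (hf : Continuous f) (hR : R ∈ openBaseInterval k)
    (hB : RightBranch (curv n k) f R M p q U V) (hq : Ioo R q ⊆ openBaseInterval k)
    (hB' : RightBranch (fun r => -curv n k (-r)) f (-R) M p' q' U' V')
    (hq' : Ioo (-R) q' ⊆ Ioo (-R) 0) :
    ∃ Y, IsRadialSolution n k f R M (Ioo (-q') q) Y ∧ EqOn Y U (Ico R q) ∧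
      EqOn (fun r => Y (-r)) U' (Ico (-R) q') := by
  have hRq := hB.lt_p.trans hB.lt_q
  have hRq' := hB'.lt_p.trans hB'.lt_q
  let Y : ℝ → ℝ := fun r => if r < R then U' (-r) else U r
  -- Reflection changes the sign of the slope; the pieces match at `R` since both slopes vanish
  -- there.
  let Z : ℝ → ℝ := fun r => if r < R then -V' (-r) else V r
  have hneg : ∀ r ∈ Ioo (-q') R, -r ∈ Ioo (-R) q' := fun r hr =>
    ⟨by linarith [hr.2], by linarith [hr.1]⟩
  have hlt : ∀ r < R, Y r = U' (-r) ∧ Z r = -V' (-r) := fun r hr => by simp [Y, Z, hr]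
  have hge : ∀ r, R ≤ r → Y r = U r ∧ Z r = V r := fun r hr => by simp [Y, Z, not_lt.2 hr]
  have hle : ∀ r ≤ R, Y r = U' (-r) ∧ Z r = -V' (-r) := by
    intro r hr
    rcases hr.eq_or_lt with h | h
    · subst h
      rw [(hge r le_rfl).1, (hge r le_rfl).2, hB.sol.value, hB'.sol.value, hB.sol.slope,
        hB'.sol.slope, neg_zero]
      exact ⟨rfl, rfl⟩
    · exact hlt r h
  have hbase : ∀ r ∈ Ioo (-q') q, r ∈ openBaseInterval k := by
    intro r hr
    rcases lt_trichotomy r R with h | h | h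
    · have := neg_mem_openBaseInterval hR (hq' (hneg r ⟨hr.1, h⟩))
      rwa [neg_neg] at this
    · rw [h]; exact hR
    · exact hq ⟨h, hr.2⟩
  have hnegS : ∀ {g : ℝ → ℝ} {g' r : ℝ}, HasDerivAt g g' (-r) →
      HasDerivAt (fun x => g (-x)) (-g') r := by
    intro g g' r hg
    exact (hg.scomp r (hasDerivAt_neg r)).congr_deriv (by simp)
  have hnegW : ∀ {g : ℝ → ℝ} {g' : ℝ}, HasDerivWithinAt g g' (Ici (-R)) (-R) →
      HasDerivWithinAt (fun x => g (-x)) (-g') (Iic R) R := by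
    intro g g' hg
    have hmaps : MapsTo (fun x : ℝ => -x) (Iic R) (Ici (-R)) := fun x hx =>
      neg_le_neg (show x ≤ R from hx)
    exact (hg.scomp R (hasDerivAt_neg R).hasDerivWithinAt hmaps).congr_deriv (by simp)
  have hboth : ∀ r ∈ Ioo (-q') q, HasDerivAt Y (Z r) r ∧
      HasDerivAt Z (-(curv n k r * Z r) - f (Y r)) r := by
    intro r hr
    rcases lt_trichotomy r R with h | h | h
    · have hr' := hneg r ⟨hr.1, h⟩
      rw [(hlt r h).1, (hlt r h).2]
      have hev : ∀ᶠ x in 𝓝 r, x < R := Iio_mem_nhds h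
      constructor
      · refine (hnegS (hB'.sol.derivU _ hr')).congr_of_eventuallyEq ?_
        filter_upwards [hev] with x hx using (hlt x hx).1
      · have := (hnegS (hB'.sol.derivV _ hr')).neg
        refine (this.congr_of_eventuallyEq ?_).congr_deriv ?_
        · filter_upwards [hev] with x hx using (hlt x hx).2
        · simp only [neg_neg]
          ring
    · subst h
      have hS : HalfDomain r (Ioo r q) := HalfDomain.Ioo
      have hS' : HalfDomain (-r) (Ioo (-r) q') := HalfDomain.Ioo
      have hb : (r + q) / 2 ∈ Ioo r q := ⟨by linarith, by linarith⟩
      have hb' : (-r + q') / 2 ∈ Ioo (-r) q' := ⟨by linarith, by linarith⟩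
      have hcurv := curv_continuousAt (n := n) hR
      have hcurv' : ContinuousAt (fun r => -curv n k (-r)) (-r) := by
        refine ContinuousAt.neg (ContinuousAt.comp (g := curv n k) ?_ continuous_neg.continuousAt)
        rwa [neg_neg]
      have d1 := hB.sol.hasDerivWithinAt hS hb
      have d2 := hnegW (hB'.sol.hasDerivWithinAt hS' hb')
      have d3 := hB.sol.hasDerivWithinAt_slope hS hb hcurv hf
      have d4 := (hnegW (hB'.sol.hasDerivWithinAt_slope hS' hb' hcurv' hf)).neg
      have e1 : HasDerivWithinAt Y 0 (Ici r) r :=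
        d1.congr (fun x hx => (hge x hx).1) (hge r le_rfl).1
      have e2 : HasDerivWithinAt Y 0 (Iic r) r := by
        have := d2.congr (fun x hx => (hle x hx).1) (hle r le_rfl).1
        simpa using this
      have e3 : HasDerivWithinAt Z (-f M) (Ici r) r :=
        d3.congr (fun x hx => (hge x hx).2) (hge r le_rfl).2
      have e4 : HasDerivWithinAt Z (-f M) (Iic r) r := by
        have := d4.congr (fun x hx => (hle x hx).2) (hle r le_rfl).2
        simpa using this
      rw [(hge r le_rfl).1, (hge r le_rfl).2, hB.sol.value, hB.sol.slope, mul_zero, neg_zero,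
        zero_sub]
      have hun : Iic r ∪ Ici r = univ := Iic_union_Ici
      constructor
      · rw [← hasDerivWithinAt_univ, ← hun]; exact e2.union e1
      · rw [← hasDerivWithinAt_univ, ← hun]; exact e4.union e3
    · have hr' : r ∈ Ioo R q := ⟨h, hr.2⟩
      rw [(hge r h.le).1, (hge r h.le).2]
      have hev : ∀ᶠ x in 𝓝 r, R < x := Ioi_mem_nhds h
      constructor
      · refine (hB.sol.derivU _ hr').congr_of_eventuallyEq ?_
        filter_upwards [hev] with x hx using (hge x hx.le).1
      · refine (hB.sol.derivV _ hr').congr_of_eventuallyEq ?_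
        filter_upwards [hev] with x hx using (hge x hx.le).2
  have hRmem : R ∈ Ioo (-q') q := ⟨by linarith, hRq⟩
  have hYR : Y R = M := by rw [(hge R le_rfl).1, hB.sol.value]
  refine ⟨Y, ⟨⟨Ioo (-q') q, isOpen_Ioo, ?_⟩, ordConnected_Ioo, hRmem, fun r hr =>
    (hboth r hr).1.continuousAt.continuousWithinAt, fun r hr _ => (hboth r hr).1.differentiableAt,
    fun r hr _ => ?_, hYR, ?_⟩, fun r hr => (hge r hr.1).1, fun r hr => ?_⟩
  · exact (inter_eq_left.2 fun r hr => openBaseInterval_subset k (hbase r hr)).symm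
  · rw [(hboth r hr).1.deriv]
    refine (hboth r hr).2.congr_of_eventuallyEq ?_
    filter_upwards [isOpen_Ioo.mem_nhds hr] with x hx using (hboth x hx).1.deriv
  · have := (hboth R hRmem).1.hasDerivWithinAt (s := Ioo (-q') q)
    rwa [(hge R le_rfl).2, hB.sol.slope] at this
  · simp only
    rw [(hle (-r) (by linarith [hr.1])).1, neg_neg]

/-! ### Uniqueness and the maximal solution. -/

theorem IsRadialSolution.isOpen_inter {n : ℕ} {k R M : ℝ} {f U : ℝ → ℝ} {J : Set ℝ}
    (hU : IsRadialSolution n k f R M J U) : IsOpen (J ∩ Ioi 0) := by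
  obtain ⟨O, hO, rfl⟩ := hU.relOpen
  have : O ∩ baseInterval k ∩ Ioi 0 = O ∩ openBaseInterval k := by
    ext r
    exact ⟨fun h => ⟨h.1.1, h.2, h.1.2.2⟩, fun h => ⟨⟨h.1, openBaseInterval_subset k h.2⟩, h.2.1⟩⟩
  rw [this]
  exact hO.inter (isOpen_openBaseInterval k)

theorem IsRadialSolution.subset {n : ℕ} {k R M : ℝ} {f U : ℝ → ℝ} {J : Set ℝ}
    (hU : IsRadialSolution n k f R M J U) : J ⊆ baseInterval k := by
  obtain ⟨O, hO, rfl⟩ := hU.relOpen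
  exact inter_subset_right

theorem IsRadialSolution.mem_nhds {n : ℕ} {k R M r : ℝ} {f U : ℝ → ℝ} {J : Set ℝ}
    (hU : IsRadialSolution n k f R M J U) (hr : r ∈ J) (h0 : 0 < r) : J ∈ 𝓝 r :=
  mem_of_superset (hU.isOpen_inter.mem_nhds ⟨hr, h0⟩) inter_subset_left

theorem IsRadialSolution.deriv_eq_zero {n : ℕ} {k R M : ℝ} {f U : ℝ → ℝ} {J : Set ℝ}
    (hU : IsRadialSolution n k f R M J U) (h0 : 0 < R) : deriv U R = 0 :=
  (hU.deriv_core.hasDerivAt (hU.mem_nhds hU.core_mem h0)).deriv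

/-- At the origin a solution is only known to have one-sided derivative `0`, while uniqueness needs
a continuous slope. Since `U(r) - U(0) = o(r)`, the mean value theorem yields `ξ ∈ (0, r)` with
small `U'(ξ)`. Integrating `(w U')' = -w f(U)` from `ξ` to `r`, with `w ξ ≤ C w r`, carries the
smallness to `U'(r)`. -/
theorem IsRadialSolution.tendsto_deriv_zero {n : ℕ} (hn : 2 ≤ n) {k M : ℝ} {f U : ℝ → ℝ}
    {J : Set ℝ} (hf : Continuous f) (hU : IsRadialSolution n k f 0 M J U) {b : ℝ} (hb : b ∈ J)
    (hb0 : 0 < b) : Tendsto (deriv U) (𝓝[>] 0) (𝓝 0) := by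
  have hIcc : Icc 0 b ⊆ J := hU.ordConnected.out hU.core_mem hb
  have hbS : b ∈ openBaseInterval k ∩ Ioi 0 :=
    ⟨openBaseInterval_mem_of_le (hU.subset hb) hb0 le_rfl, hb0⟩
  have hS := halfDomain_right k 0 le_rfl
  have hw := halfWeight_right hn k 0
  obtain ⟨C, hC, hwC⟩ := hw.exists_le_mul hS hbS
  obtain ⟨B, hB⟩ := isCompact_Icc.exists_bound_of_continuousOn
    (hf.comp_continuousOn (hU.continuousOn.mono hIcc))
  have hB0 : 0 ≤ B := (norm_nonneg _).trans (hB 0 ⟨le_rfl, hb0.le⟩)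
  have hmain : ∀ ε > 0, ∀ᶠ r in 𝓝[>] (0 : ℝ), |deriv U r| ≤ C * ε + C * B * r := by
    intro ε hε
    have h1 : ∀ᶠ r in 𝓝[>] (0 : ℝ), ‖U r - U 0 - (r - 0) • (0 : ℝ)‖ ≤ ε * ‖r - 0‖ := by
      have hd : HasDerivWithinAt U 0 (Ioc 0 b) 0 :=
        hU.deriv_core.mono fun x hx => hIcc ⟨hx.1.le, hx.2⟩
      have := (hasDerivAtFilter_iff_isLittleO.1 hd).def hε
      rw [← nhdsWithin_Ioc_eq_nhdsGT hb0]
      simpa using this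
    filter_upwards [h1, Ioc_mem_nhdsGT hb0] with r h1 hr
    simp only [smul_zero, sub_zero, Real.norm_eq_abs, abs_of_pos hr.1] at h1
    have hIr : Icc 0 r ⊆ Icc 0 b := Icc_subset_Icc_right hr.2
    obtain ⟨ξ, hξ, hξd⟩ := exists_deriv_eq_slope U hr.1 (hU.continuousOn.mono (hIr.trans hIcc))
      fun x hx => (hU.differentiableAt x (hIcc (hIr ⟨hx.1.le, hx.2.le⟩))
        hx.1).differentiableWithinAt
    have h2 : |deriv U ξ| ≤ ε := by
      rw [hξd, sub_zero, abs_div, abs_of_pos hr.1, div_le_iff₀ hr.1]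
      exact h1
    have hwr : 0 < area n k r := hw.pos r (hS.Ioc_subset b hbS hr)
    have h3 : ‖area n k r * deriv U r - area n k ξ * deriv U ξ‖ ≤
        C * area n k r * B * ‖r - ξ‖ := by
      refine Convex.norm_image_sub_le_of_norm_hasDerivWithin_le
        (f := fun x => area n k x * deriv U x) (f' := fun x => -(area n k x * f (U x)))
        (s := Icc ξ r) (fun x hx => ?_) (fun x hx => ?_) (convex_Icc _ _)
        (left_mem_Icc.2 hξ.2.le) (right_mem_Icc.2 hξ.2.le)
      · have hx0 : 0 < x := hξ.1.trans_le hx.1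
        have hxb : x ≤ b := hx.2.trans hr.2
        have hxS := hS.Ioc_subset b hbS ⟨hx0, hxb⟩
        refine (((hw.deriv x hxS).mul (hU.ode x (hIcc ⟨hx0.le, hxb⟩)
          hx0)).congr_deriv ?_).hasDerivWithinAt
        simp only [curv]
        ring
      · have hx0 : 0 < x := hξ.1.trans_le hx.1
        have hxb : x ≤ b := hx.2.trans hr.2
        rw [norm_neg, norm_mul, Real.norm_eq_abs, abs_of_pos
          (hw.pos x (hS.Ioc_subset b hbS ⟨hx0, hxb⟩))]
        exact mul_le_mul (hwC x r hx0.le hx.2 hr.2 hr.1) (hB x ⟨hx0.le, hxb⟩) (norm_nonneg _)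
          (by positivity)
    have h4 : area n k ξ * |deriv U ξ| ≤ C * area n k r * ε :=
      mul_le_mul (hwC ξ r hξ.1.le hξ.2.le hr.2 hr.1) h2 (abs_nonneg _) (by positivity)
    have h5 : area n k r * |deriv U r| ≤ C * area n k r * B * (r - ξ) + C * area n k r * ε := by
      have hwξ : 0 < area n k ξ := hw.pos ξ (hS.Ioc_subset b hbS ⟨hξ.1, hξ.2.le.trans hr.2⟩)
      rw [Real.norm_eq_abs, Real.norm_eq_abs, abs_of_pos (sub_pos.2 hξ.2)] at h3
      have h6 := abs_sub_abs_le_abs_sub (area n k r * deriv U r) (area n k ξ * deriv U ξ)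
      rw [abs_mul, abs_mul, abs_of_pos hwr, abs_of_pos hwξ] at h6
      linarith
    have h7 : C * area n k r * B * (r - ξ) ≤ C * area n k r * B * r :=
      mul_le_mul_of_nonneg_left (by linarith [hξ.1]) (by positivity)
    refine le_of_mul_le_mul_left ?_ hwr
    calc area n k r * |deriv U r| ≤ C * area n k r * B * r + C * area n k r * ε := by linarith
      _ = _ := by ring
  rw [Metric.tendsto_nhds]
  intro η hη
  have h8 : ∀ᶠ r in 𝓝[>] (0 : ℝ), C * B * r < η / 2 := by
    have hc : Continuous fun r : ℝ => C * B * r := by fun_prop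
    have := (hc.tendsto 0).mono_left (nhdsWithin_le_nhds (s := Ioi 0))
    rw [mul_zero] at this
    exact this.eventually (gt_mem_nhds (by linarith))
  filter_upwards [hmain (η / (4 * C)) (by positivity), h8] with r h9 h10
  rw [Real.dist_eq, sub_zero]
  have h11 : C * (η / (4 * C)) = η / 4 := by field_simp
  linarith

theorem HalfDomain.inter {R : ℝ} {S T : Set ℝ} (hS : HalfDomain R S) (hT : HalfDomain R T) :
    HalfDomain R (S ∩ T) :=
  ⟨hS.isOpen.inter hT.isOpen, fun r hr => hS.lt r hr.1, fun r hr _ hx =>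
    ⟨hS.Ioc_subset r hr.1 hx, hT.Ioc_subset r hr.2 hx⟩⟩

theorem IsRadialSolution.halfDomain_right {n : ℕ} {k R M : ℝ} {f U : ℝ → ℝ} {J : Set ℝ}
    (hU : IsRadialSolution n k f R M J U) : HalfDomain R (J ∩ Ioi R) := by
  have h0 : 0 ≤ R := (hU.subset hU.core_mem).1
  refine ⟨?_, fun r hr => hr.2, fun r hr x hx => ⟨hU.ordConnected.out hU.core_mem hr.1
    ⟨hx.1.le, hx.2⟩, hx.1⟩⟩
  have : J ∩ Ioi R = J ∩ Ioi 0 ∩ Ioi R := by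
    ext r
    exact ⟨fun h => ⟨⟨h.1, h0.trans_lt h.2⟩, h.2⟩, fun h => ⟨h.1.1, h.2⟩⟩
  rw [this]
  exact hU.isOpen_inter.inter isOpen_Ioi

/-- The slope is set to `0` at `R` by hand because for `R = 0` the two-sided `deriv U 0` depends on
values outside the domain. -/
theorem IsRadialSolution.halfSolution_right {n : ℕ} (hn : 2 ≤ n) {k R M : ℝ} {f U : ℝ → ℝ}
    {J : Set ℝ} (hf : Continuous f) (hU : IsRadialSolution n k f R M J U) :
    HalfSolution (curv n k) f R M (J ∩ Ioi R) U (fun r => if r = R then 0 else deriv U r) := by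
  have h0 : 0 ≤ R := (hU.subset hU.core_mem).1
  have hS := hU.halfDomain_right
  have hne : ∀ r ∈ J ∩ Ioi R, r ≠ R := fun r hr => (ne_of_gt hr.2)
  have hdV : ∀ r ∈ J ∩ Ioi R, HasDerivAt (fun r => if r = R then 0 else deriv U r)
      (-(curv n k r * (if r = R then 0 else deriv U r)) - f (U r)) r := by
    intro r hr
    rw [if_neg (hne r hr)]
    refine (hU.ode r hr.1 (h0.trans_lt hr.2)).congr_of_eventuallyEq ?_
    filter_upwards [hS.isOpen.mem_nhds hr] with x hx using if_neg (hne x hx)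
  refine ⟨hU.continuousOn.mono ?_, ?_, hU.value_core, if_pos rfl, fun r hr => ?_, hdV⟩
  · exact insert_subset hU.core_mem inter_subset_left
  · intro r hr
    rcases hr with rfl | hr
    · rcases (J ∩ Ioi r).eq_empty_or_nonempty with he | ⟨b, hb⟩
      · rw [he]; simp
      · rw [continuousWithinAt_insert_self]
        have hlim : Tendsto (deriv U) (𝓝[>] r) (𝓝 0) := by
          rcases h0.eq_or_lt with h | h
          · subst h
            exact hU.tendsto_deriv_zero hn hf hb.1 hb.2
          · have := (hU.ode r hU.core_mem h).continuousAt.tendsto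
            rw [hU.deriv_eq_zero h] at this
            exact this.mono_left nhdsWithin_le_nhds
        have h2 : Tendsto (deriv U) (𝓝[J ∩ Ioi r] r) (𝓝 0) :=
          hlim.mono_left (nhdsWithin_mono _ inter_subset_right)
        simp only [ContinuousWithinAt, if_true]
        refine h2.congr' ?_
        filter_upwards [self_mem_nhdsWithin] with x hx using (if_neg (hne x hx)).symm
    · exact (hdV r hr).continuousAt.continuousWithinAt
  · simp only [if_neg (hne r hr)]
    exact (hU.differentiableAt r hr.1 (h0.trans_lt hr.2)).hasDerivAt

theorem IsRadialSolution.halfDomain_left {n : ℕ} {k R M : ℝ} {f U : ℝ → ℝ} {J : Set ℝ}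
    (hU : IsRadialSolution n k f R M J U) :
    HalfDomain (-R) ((fun r => -r) ⁻¹' (J ∩ Ioo 0 R)) := by
  refine ⟨?_, fun r hr => by linarith [hr.2.2], fun r hr x hx => ?_⟩
  · have : J ∩ Ioo 0 R = J ∩ Ioi 0 ∩ Iio R := by
      ext r
      exact ⟨fun h => ⟨⟨h.1, h.2.1⟩, h.2.2⟩, fun h => ⟨h.1.1, h.1.2, h.2⟩⟩
    rw [this]
    exact (hU.isOpen_inter.inter isOpen_Iio).preimage continuous_neg
  · have h1 : -x < R := by linarith [hx.1]
    have h2 : -r ≤ -x := neg_le_neg hx.2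
    exact ⟨hU.ordConnected.out hr.1 hU.core_mem ⟨h2, h1.le⟩, hr.2.1.trans_le h2, h1⟩

theorem IsRadialSolution.halfSolution_left {n : ℕ} {k R M : ℝ} {f U : ℝ → ℝ}
    {J : Set ℝ} (hU : IsRadialSolution n k f R M J U) (h0 : 0 < R) :
    HalfSolution (fun r => -curv n k (-r)) f (-R) M ((fun r => -r) ⁻¹' (J ∩ Ioo 0 R))
      (fun r => U (-r)) (fun r => -deriv U (-r)) := by
  have hnegS : ∀ {g : ℝ → ℝ} {g' r : ℝ}, HasDerivAt g g' (-r) →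
      HasDerivAt (fun x => g (-x)) (-g') r := by
    intro g g' r hg
    exact (hg.scomp r (hasDerivAt_neg r)).congr_deriv (by simp)
  have hdU : ∀ r, -r ∈ J → 0 < -r → HasDerivAt (fun r => U (-r)) (-deriv U (-r)) r :=
    fun r hr hr0 => hnegS (hU.differentiableAt _ hr hr0).hasDerivAt
  have hdV : ∀ r, -r ∈ J → 0 < -r → HasDerivAt (fun r => -deriv U (-r))
      (-(-curv n k (-r) * -deriv U (-r)) - f (U (-r))) r := by
    intro r hr hr0
    refine (hnegS (hU.ode _ hr hr0)).neg.congr_deriv ?_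
    simp only [curv]
    ring
  have hins : ∀ r ∈ insert (-R) ((fun r => -r) ⁻¹' (J ∩ Ioo 0 R)), -r ∈ J ∧ 0 < -r := by
    rintro r (rfl | hr)
    · rw [neg_neg]; exact ⟨hU.core_mem, h0⟩
    · exact ⟨hr.1, hr.2.1⟩
  refine ⟨fun r hr => ?_, fun r hr => ?_, ?_, ?_, fun r hr => hdU r hr.1 hr.2.1,
    fun r hr => hdV r hr.1 hr.2.1⟩
  · exact (hdU r (hins r hr).1 (hins r hr).2).continuousAt.continuousWithinAt
  · exact (hdV r (hins r hr).1 (hins r hr).2).continuousAt.continuousWithinAt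
  · simp [hU.value_core]
  · simp [hU.deriv_eq_zero h0]

/-- Uniqueness for the Cauchy problem. -/
theorem IsRadialSolution.eq {n : ℕ} (hn : 2 ≤ n) {k R M : ℝ} {f U₁ U₂ : ℝ → ℝ} {J₁ J₂ : Set ℝ}
    (hf : ContDiff ℝ 1 f) (h₁ : IsRadialSolution n k f R M J₁ U₁)
    (h₂ : IsRadialSolution n k f R M J₂ U₂) {r : ℝ} (hr₁ : r ∈ J₁) (hr₂ : r ∈ J₂) :
    U₁ r = U₂ r := by
  have hR : R ∈ baseInterval k := h₁.subset h₁.core_mem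
  have hfB := boundedLipschitz_of_contDiff hf
  rcases lt_trichotomy r R with hlt | heq | hgt
  · have hR0 : 0 < R := (h₁.subset hr₁).1.trans_lt hlt
    have hRo : R ∈ openBaseInterval k := ⟨hR0, hR.2⟩
    have hpos : ∀ x, 0 < x → r ≤ x → x < R → U₁ x = U₂ x := by
      intro x hx hrx hxR
      have hS := h₁.halfDomain_left.inter h₂.halfDomain_left
      have hanti := ((halfWeight_left hn hRo).anti.antitoneOn.mono (fun y hy =>
        ⟨by linarith [hy.1.2.2], by linarith [hy.1.2.1]⟩ :
        (fun r => -r) ⁻¹' (J₁ ∩ Ioo 0 R) ∩ (fun r => -r) ⁻¹' (J₂ ∩ Ioo 0 R) ⊆ Ioo (-R) 0))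
      have hx' : -x ∈ (fun r => -r) ⁻¹' (J₁ ∩ Ioo 0 R) ∩ (fun r => -r) ⁻¹' (J₂ ∩ Ioo 0 R) := by
        simp only [mem_inter_iff, mem_preimage, neg_neg]
        exact ⟨⟨h₁.ordConnected.out hr₁ h₁.core_mem ⟨hrx, hxR.le⟩, hx, hxR⟩,
          ⟨h₂.ordConnected.out hr₂ h₂.core_mem ⟨hrx, hxR.le⟩, hx, hxR⟩⟩
      have := (HalfSolution.eqOn hS hanti hfB ((h₁.halfSolution_left hR0).mono inter_subset_left)
        ((h₂.halfSolution_left hR0).mono inter_subset_right) (-x) (Or.inr hx')).1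
      simpa using this
    -- The equation says nothing at the origin, so there equality follows by continuity from
    -- positive radii.
    rcases (h₁.subset hr₁).1.eq_or_lt with h0 | h0
    · subst h0
      have hsub : ∀ {J : Set ℝ} {U : ℝ → ℝ}, IsRadialSolution n k f R M J U → (0 : ℝ) ∈ J →
          Tendsto U (𝓝[>] 0) (𝓝 (U 0)) := by
        intro J U hU h0J
        have h3 : ContinuousWithinAt U (Ioo 0 R) 0 := (hU.continuousOn 0 h0J).mono
          fun x hx => hU.ordConnected.out h0J hU.core_mem ⟨hx.1.le, hx.2.le⟩
        rw [← nhdsWithin_Ioo_eq_nhdsGT hR0]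
        exact h3
      refine tendsto_nhds_unique_of_eventuallyEq (hsub h₁ hr₁) (hsub h₂ hr₂) ?_
      filter_upwards [Ioo_mem_nhdsGT hR0] with x hx using hpos x hx.1 hx.1.le hx.2
    · exact hpos r h0 le_rfl hlt
  · rw [heq, h₁.value_core, h₂.value_core]
  · have hS := h₁.halfDomain_right.inter h₂.halfDomain_right
    have hanti : AntitoneOn (curv n k) (J₁ ∩ Ioi R ∩ (J₂ ∩ Ioi R)) :=
      (curv_strictAntiOn hn k).antitoneOn.mono fun x hx =>
        ⟨hR.1.trans_lt hx.1.2, (h₁.subset hx.1.1).2⟩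
    exact (HalfSolution.eqOn hS hanti hfB
      ((h₁.halfSolution_right hn hf.continuous).mono inter_subset_left)
      ((h₂.halfSolution_right hn hf.continuous).mono inter_subset_right) r
      (Or.inr ⟨⟨hr₁, hgt⟩, ⟨hr₂, hgt⟩⟩)).1

theorem IsRadialSolution.radialSolution_eq {n : ℕ} (hn : 2 ≤ n) {k R M : ℝ} {f U : ℝ → ℝ}
    {J : Set ℝ} (hf : ContDiff ℝ 1 f) (hU : IsRadialSolution n k f R M J U) {r : ℝ} (hr : r ∈ J) :
    radialSolution n k f R M r = U r := by
  have hex : ∃ v : ℝ, ∃ (J : Set ℝ) (U : ℝ → ℝ),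
      IsRadialSolution n k f R M J U ∧ r ∈ J ∧ U r = v := ⟨U r, J, U, hU, hr, rfl⟩
  rw [radialSolution, dif_pos hex]
  obtain ⟨J', U', hU', hr', hv⟩ := Classical.choose_spec hex
  rw [← hv]
  exact hU'.eq hn hf hU hr' hr

theorem IsRadialSolution.subset_radialDomain {n : ℕ} {k R M : ℝ} {f U : ℝ → ℝ}
    {J : Set ℝ} (hU : IsRadialSolution n k f R M J U) : J ⊆ radialDomain n k f R M :=
  fun _ hr => ⟨J, U, hU, hr⟩

/-- The maximal solution is a solution. -/
theorem IsRadialSolution.maximal {n : ℕ} (hn : 2 ≤ n) {k R M : ℝ} {f U : ℝ → ℝ}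
    {J : Set ℝ} (hf : ContDiff ℝ 1 f) (hU : IsRadialSolution n k f R M J U) :
    IsRadialSolution n k f R M (radialDomain n k f R M) (radialSolution n k f R M) := by
  set D := radialDomain n k f R M with hD
  -- Each domain of a solution is relatively open in the union `D`, so properties within `J'` pass
  -- to `D`.
  have hopen : ∀ {J' : Set ℝ} {U' : ℝ → ℝ}, IsRadialSolution n k f R M J' U' →
      ∀ r ∈ J', J' ∈ 𝓝[D] r := by
    intro J' U' hU' r hr
    obtain ⟨O, hO, hJ⟩ := hU'.relOpen
    have hrO : r ∈ O := by rw [hJ] at hr; exact hr.1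
    filter_upwards [mem_nhdsWithin_of_mem_nhds (hO.mem_nhds hrO), self_mem_nhdsWithin] with x hx hxD
    obtain ⟨J₂, U₂, h₂, hx₂⟩ := hxD
    rw [hJ]
    exact ⟨hx, h₂.subset hx₂⟩
  have hev : ∀ {J' : Set ℝ} {U' : ℝ → ℝ}, IsRadialSolution n k f R M J' U' →
      ∀ r ∈ J', 0 < r → radialSolution n k f R M =ᶠ[𝓝 r] U' := by
    intro J' U' hU' r hr h0
    filter_upwards [hU'.mem_nhds hr h0] with x hx using hU'.radialSolution_eq hn hf hx
  refine ⟨?_, ?_, ⟨J, U, hU, hU.core_mem⟩, ?_, ?_, ?_, ?_, ?_⟩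
  · refine ⟨⋃₀ {O | IsOpen O ∧ O ∩ baseInterval k ⊆ D}, isOpen_sUnion fun O hO => hO.1, ?_⟩
    ext r
    constructor
    · rintro ⟨J', U', hU', hr⟩
      obtain ⟨O, hO, hJ⟩ := hU'.relOpen
      refine ⟨⟨O, ⟨hO, ?_⟩, ?_⟩, hU'.subset hr⟩
      · rw [← hJ]; exact hU'.subset_radialDomain
      · rw [hJ] at hr; exact hr.1
    · rintro ⟨⟨O, hO, hrO⟩, hr⟩
      exact hO.2 ⟨hrO, hr⟩
  · have hDU : D = ⋃₀ {J | ∃ U, IsRadialSolution n k f R M J U} := by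
      ext r
      constructor
      · rintro ⟨J', U', hU', hr⟩
        exact ⟨J', ⟨U', hU'⟩, hr⟩
      · rintro ⟨J', ⟨U', hU'⟩, hr⟩
        exact ⟨J', U', hU', hr⟩
    rw [hDU]
    refine (isPreconnected_sUnion R _ ?_ ?_).ordConnected
    · rintro J' ⟨U', hU'⟩
      exact hU'.core_mem
    · rintro J' ⟨U', hU'⟩
      exact hU'.ordConnected.isPreconnected
  · rintro r ⟨J', U', hU', hr⟩
    have h1 : ContinuousWithinAt (radialSolution n k f R M) J' r :=
      (hU'.continuousOn r hr).congr (fun x hx => hU'.radialSolution_eq hn hf hx)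
        (hU'.radialSolution_eq hn hf hr)
    exact h1.mono_of_mem_nhdsWithin (hopen hU' r hr)
  · rintro r ⟨J', U', hU', hr⟩ h0
    exact (hU'.differentiableAt r hr h0).congr_of_eventuallyEq (hev hU' r hr h0)
  · rintro r ⟨J', U', hU', hr⟩ h0
    rw [(hev hU' r hr h0).deriv_eq, hU'.radialSolution_eq hn hf hr]
    exact (hU'.ode r hr h0).congr_of_eventuallyEq (hev hU' r hr h0).deriv
  · rw [hU.radialSolution_eq hn hf hU.core_mem, hU.value_core]
  · have h1 : HasDerivWithinAt (radialSolution n k f R M) 0 J R :=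
      hU.deriv_core.congr (fun x hx => hU.radialSolution_eq hn hf hx)
        (hU.radialSolution_eq hn hf hU.core_mem)
    exact h1.mono_of_mem_nhdsWithin (hopen hU R hU.core_mem)

/-! ### Zeros and boundary slopes of the maximal solution. -/

/-- The right branch of the maximal solution, with zero `p`. -/
def HasRightBranch (n : ℕ) (k : ℝ) (f : ℝ → ℝ) (M R p q : ℝ) (V : ℝ → ℝ) : Prop :=
  RightBranch (curv n k) f R M p q (radialSolution n k f R M) V ∧
    Ioo R q ⊆ openBaseInterval k ∧ Ico R q ⊆ radialDomain n k f R M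

/-- The reflected left branch of the maximal solution, with zero `-p`. -/
def HasLeftBranch (n : ℕ) (k : ℝ) (f : ℝ → ℝ) (M R p q : ℝ) (V : ℝ → ℝ) : Prop :=
  RightBranch (fun r => -curv n k (-r)) f (-R) M p q (fun r => radialSolution n k f R M (-r)) V ∧
    Ioo (-R) q ⊆ Ioo (-R) 0 ∧ ∀ r ∈ Ico (-R) q, -r ∈ radialDomain n k f R M

theorem exists_branches {n : ℕ} (hn : 2 ≤ n) {k R M : ℝ} {f : ℝ → ℝ}
    (hR : R ∈ baseInterval k) (hf : ContDiff ℝ 1 f) (hM : 0 < M)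
    (hfpos : ∀ x ∈ Ioc 0 M, 0 < f x)
    (hfm : k ≤ 0 → ∃ m, 0 < m ∧ ∀ x ∈ Ioc 0 M, m ≤ f x) :
    IsRadialSolution n k f R M (radialDomain n k f R M) (radialSolution n k f R M) ∧
    (∃ p q V, HasRightBranch n k f M R p q V) ∧
    (0 < R → ∃ p q V, HasLeftBranch n k f M R p q V) := by
  have hfB := boundedLipschitz_of_contDiff hf
  obtain ⟨p, q, U, V, hB, hq⟩ := exists_rightBranch_right hn hR hfB hM hfpos hfm
  have hq' := hq.trans inter_subset_left
  rcases hR.1.eq_or_lt with h | h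
  · subst h
    have hU := isRadialSolution_zero hB hq'
    refine ⟨hU.maximal hn hf, ⟨p, q, V, hB.congr fun r hr => hU.radialSolution_eq hn hf hr, hq',
      hU.subset_radialDomain⟩, fun h => absurd h (lt_irrefl _)⟩
  · have hRo : R ∈ openBaseInterval k := ⟨h, hR.2⟩
    obtain ⟨p', q', U', V', hB', hql⟩ := exists_rightBranch_left hn hRo hfB hM hfpos
    obtain ⟨Y, hY, hYU, hYU'⟩ := exists_isRadialSolution_pos hf.continuous hRo hB hq' hB' hql
    have hlt : -q' < R := by linarith [hB'.lt_p.trans hB'.lt_q]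
    have hRq := hB.lt_p.trans hB.lt_q
    have hr1 : ∀ r ∈ Ico R q, r ∈ Ioo (-q') q := fun r hr => ⟨hlt.trans_le hr.1, hr.2⟩
    have hr2 : ∀ r ∈ Ico (-R) q', -r ∈ Ioo (-q') q := fun r hr =>
      ⟨by linarith [hr.2], by linarith [hr.1]⟩
    refine ⟨hY.maximal hn hf, ⟨p, q, V, hB.congr fun r hr => ?_, hq', fun r hr =>
      hY.subset_radialDomain (hr1 r hr)⟩, fun _ => ⟨p', q', V', hB'.congr fun r hr => ?_, hql,
      fun r hr => hY.subset_radialDomain (hr2 r hr)⟩⟩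
    · rw [hY.radialSolution_eq hn hf (hr1 r hr), hYU hr]
    · exact (hY.radialSolution_eq hn hf (hr2 r hr)).trans (hYU' hr)

theorem HasRightBranch.rPlus_eq {n : ℕ} {k M R p q : ℝ} {f V : ℝ → ℝ}
    (hB : HasRightBranch n k f M R p q V) : rPlus n k f R M = p := by
  obtain ⟨hB, -, hD⟩ := hB
  refine IsLeast.csInf_eq ⟨⟨hD ⟨hB.lt_p.le, hB.lt_q⟩, hB.lt_p, hB.zero⟩, fun r hr => ?_⟩
  by_contra hc
  exact (hB.pos r ⟨hr.2.1.le, not_le.1 hc⟩).ne' hr.2.2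

theorem HasLeftBranch.rMinus_eq {n : ℕ} {k M R p q : ℝ} {f V : ℝ → ℝ}
    (hB : HasLeftBranch n k f M R p q V) (hR : 0 < R) : rMinus n k f R M = -p := by
  obtain ⟨hB, -, hD⟩ := hB
  rw [rMinus, if_neg hR.ne']
  refine IsGreatest.csSup_eq ⟨⟨hD p ⟨hB.lt_p.le, hB.lt_q⟩, by linarith [hB.lt_p], hB.zero⟩,
    fun r hr => ?_⟩
  by_contra hc
  have := hB.pos (-r) ⟨by linarith [hr.2.1], by linarith [not_le.1 hc]⟩
  rw [neg_neg] at this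
  exact this.ne' hr.2.2

theorem HasRightBranch.deriv_eq {n : ℕ} {k M R p q : ℝ} {f V : ℝ → ℝ}
    (hB : HasRightBranch n k f M R p q V) {r : ℝ} (hr : r ∈ Ioo R q) :
    deriv (radialSolution n k f R M) r = V r :=
  (hB.1.sol.derivU r hr).deriv

theorem HasLeftBranch.deriv_eq {n : ℕ} {k M R p q : ℝ} {f V : ℝ → ℝ}
    (hB : HasLeftBranch n k f M R p q V) {r : ℝ} (hr : r ∈ Ioo (-R) q) :
    deriv (radialSolution n k f R M) (-r) = -V r := by
  have := (hB.1.sol.derivU r hr).deriv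
  rw [deriv_comp_neg] at this
  linarith

theorem isAdmissiblePair_of_branches {n : ℕ} {k M R p q : ℝ} {f V : ℝ → ℝ} (hR : 0 ≤ R)
    (hM : 0 < M)
    (hU : IsRadialSolution n k f R M (radialDomain n k f R M) (radialSolution n k f R M))
    (hB : HasRightBranch n k f M R p q V)
    (hL : 0 < R → ∃ p q V, HasLeftBranch n k f M R p q V) : IsAdmissiblePair n k f R M := by
  have hp := hB.rPlus_eq
  have hlt := hB.1.lt_p
  have hright : ∀ r ∈ Ico R p, 0 < radialSolution n k f R M r := hB.1.pos
  have hrightD : ∀ r ∈ Ioo R p, deriv (radialSolution n k f R M) r ≠ 0 := by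
    intro r hr
    have hr' : r ∈ Ioo R q := ⟨hr.1, hr.2.trans hB.1.lt_q⟩
    rw [hB.deriv_eq hr']
    exact (hB.1.slope_neg r hr').ne
  have hminus : ∀ {p' q' : ℝ} {V' : ℝ → ℝ}, 0 < R → HasLeftBranch n k f M R p' q' V' →
      rMinus n k f R M = -p' ∧ 0 < -p' ∧ -p' < R ∧ -p' ∈ radialDomain n k f R M := by
    intro p' q' V' h0 hL'
    have h1 := hL'.1.lt_p
    have h2 := hL'.2.1 ⟨h1, hL'.1.lt_q⟩
    exact ⟨hL'.rMinus_eq h0, by linarith [h2.2], by linarith, hL'.2.2 p' ⟨h1.le, hL'.1.lt_q⟩⟩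
  have hmem : rMinus n k f R M ∈ radialDomain n k f R M := by
    rcases hR.eq_or_lt with h | h
    · rw [rMinus, if_pos h.symm]
      have := hU.core_mem
      rwa [← h] at this ⊢
    · obtain ⟨p', q', V', hL'⟩ := hL h
      rw [(hminus h hL').1]
      exact (hminus h hL').2.2.2
  have hleft : ∀ r ∈ Ioo (rMinus n k f R M) R, 0 < radialSolution n k f R M r ∧
      deriv (radialSolution n k f R M) r ≠ 0 := by
    intro r hr
    rcases hR.eq_or_lt with h | h
    · rw [rMinus, if_pos h.symm, ← h] at hr
      exact absurd (hr.1.trans hr.2) (lt_irrefl _)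
    · obtain ⟨p', q', V', hL'⟩ := hL h
      rw [(hminus h hL').1] at hr
      have hr' : -r ∈ Ioo (-R) p' := ⟨by linarith [hr.2], by linarith [hr.1]⟩
      have hr'' : -r ∈ Ioo (-R) q' := ⟨hr'.1, hr'.2.trans hL'.1.lt_q⟩
      constructor
      · have := hL'.1.pos (-r) ⟨hr'.1.le, hr'.2⟩
        rwa [neg_neg] at this
      · have := hL'.deriv_eq hr''
        rw [neg_neg] at this
        rw [this]
        exact (neg_pos.2 (hL'.1.slope_neg _ hr'')).ne'
  refine ⟨hU, ?_, by rwa [hp], fun h => ?_, ?_, fun r hr => ?_, fun r hr hne => ?_, ?_, fun h => ?_⟩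
  · rw [hp]
    exact hU.ordConnected.out hmem (hB.2.2 ⟨hlt.le, hB.1.lt_q⟩)
  · obtain ⟨p', q', V', hL'⟩ := hL h
    obtain ⟨h1, h2, h3, -⟩ := hminus h hL'
    rw [h1]
    exact ⟨h2, h3⟩
  · rwa [hU.value_core]
  · rw [hp] at hr
    rcases lt_or_ge r R with h | h
    · exact (hleft r ⟨hr.1, h⟩).1
    · exact hright r ⟨h, hr.2⟩
  · rw [hp] at hr
    rcases lt_or_gt_of_ne hne with h | h
    · exact (hleft r ⟨hr.1, h⟩).2
    · exact hrightD r ⟨h, hr.2⟩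
  · rw [hp]; exact hB.1.zero
  · obtain ⟨p', q', V', hL'⟩ := hL h
    rw [(hminus h hL').1]
    exact hL'.1.zero

/-- The condition `x f'(x) ≤ f(x)` says that `f(x)/x` has nonpositive derivative; the product form
is the one used in the Wronskian. -/
theorem mul_le_mul_of_mul_deriv_le {f : ℝ → ℝ} {Mbar : ℝ} (hf : Differentiable ℝ f)
    (hcond : ∀ x : ℝ, 0 < x → x < Mbar → x * deriv f x ≤ f x) {x y : ℝ} (hx : 0 < x) (hxy : x ≤ y)
    (hy : y < Mbar) : x * f y ≤ y * f x := by
  have hder : ∀ z, 0 < z → HasDerivAt (fun z => f z / z) ((deriv f z * z - f z * 1) / z ^ 2) z :=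
    fun z hz => (hf z).hasDerivAt.div (hasDerivAt_id z) hz.ne'
  have hanti : AntitoneOn (fun z => f z / z) (Icc x y) := by
    refine antitoneOn_of_deriv_nonpos (convex_Icc x y) (fun z hz =>
      (hder z (hx.trans_le hz.1)).continuousAt.continuousWithinAt) (fun z hz => ?_) fun z hz => ?_
    · rw [interior_Icc] at hz
      exact (hder z (hx.trans hz.1)).differentiableAt.differentiableWithinAt
    · rw [interior_Icc] at hz
      rw [(hder z (hx.trans hz.1)).deriv]
      have := hcond z (hx.trans hz.1) (hz.2.trans hy)
      exact div_nonpos_of_nonpos_of_nonneg (by linarith) (sq_nonneg z)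
  have h1 := hanti ⟨le_rfl, hxy⟩ ⟨hxy, le_rfl⟩ hxy
  simp only at h1
  rw [div_le_div_iff₀ (hx.trans_le hxy) hx] at h1
  linarith

end RadialModel

/-! ### Assembly. -/

theorem mainTheorem9 (n : ℕ) (hn : 2 ≤ n) (k : ℝ) (f : ℝ → ℝ) (hf : ContDiff ℝ 1 f)
    (I : Set ℝ) (hI : RadialModel.StandardConditions n k f I)
    (Mbar : ℝ) (hMbar : 0 < Mbar) (hsub : Set.Ioo 0 Mbar ⊆ I)
    (hcond : ∀ x : ℝ, 0 < x → x < Mbar → x * deriv f x ≤ f x)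
    (M : ℝ) (hM : M ∈ Set.Ioo 0 Mbar) :
    (∀ R ∈ RadialModel.baseInterval k, RadialModel.IsAdmissiblePair n k f R M) ∧
    RadialModel.tauZero n k f M = RadialModel.tauPlus n k f M 0 ∧
    RadialModel.tauPlus n k f M 0 = 1 ∧
    StrictAntiOn (RadialModel.tauMinus n k f M) (RadialModel.openBaseInterval k) ∧
    StrictMonoOn (RadialModel.tauPlus n k f M) (RadialModel.openBaseInterval k) := by
  open RadialModel in
  have hM0 : 0 < M := hM.1
  have hfpos : ∀ x ∈ Ioc 0 M, 0 < f x := fun x hx =>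
    hI.pos x (hsub ⟨hx.1, hx.2.trans_lt hM.2⟩)
  -- The comparison runs down to height `0`, where for `k > 0` only `f 0 ≥ 0` is available, by
  -- continuity.
  have hf0 : ∀ x ∈ Ico 0 M, 0 ≤ f x := by
    have hcl : closure (Ioo 0 M) ⊆ {x | 0 ≤ f x} :=
      closure_minimal (fun x hx => (hfpos x ⟨hx.1, hx.2.le⟩).le)
        (isClosed_le continuous_const hf.continuous)
    rw [closure_Ioo hM0.ne] at hcl
    exact fun x hx => hcl ⟨hx.1, hx.2.le⟩
  have hfm : k ≤ 0 → ∃ m, 0 < m ∧ ∀ x ∈ Ioc 0 M, m ≤ f x := by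
    intro hk
    obtain ⟨x, hx, hmin⟩ := isCompact_Icc.exists_isMinOn (nonempty_Icc.2 hM0.le)
      hf.continuous.continuousOn
    refine ⟨f x, ?_, fun y hy => hmin ⟨hy.1.le, hy.2⟩⟩
    rcases hx.1.eq_or_lt with h | h
    · rw [← h]; exact hI.zero_pos hk
    · exact hfpos x ⟨h, hx.2⟩
  have hfr : ∀ x y, 0 < x → x ≤ y → y ≤ M → x * f y ≤ y * f x := fun x y hx hxy hy =>
    mul_le_mul_of_mul_deriv_le (hf.differentiable one_ne_zero) hcond hx hxy (hy.trans_lt hM.2)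
  have hex : ∀ R ∈ baseInterval k, _ := fun R hR => exists_branches hn hR hf hM0 hfpos hfm
  have hadm : ∀ R ∈ baseInterval k, IsAdmissiblePair n k f R M := by
    intro R hR
    obtain ⟨hU, ⟨p, q, V, hB⟩, hL⟩ := hex R hR
    exact isAdmissiblePair_of_branches hR.1 hM0 hU hB hL
  have h0 := zero_mem_baseInterval k
  have hden : 0 < deriv (radialSolution n k f 0 M) (rPlus n k f 0 M) ^ 2 := by
    obtain ⟨-, ⟨p, q, V, hB⟩, -⟩ := hex 0 h0
    have hp : p ∈ Ioo 0 q := ⟨hB.1.lt_p, hB.1.lt_q⟩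
    rw [hB.rPlus_eq, hB.deriv_eq hp]
    exact sq_pos_of_neg (hB.1.slope_neg p hp)
  -- Including the core `0` here is what identifies the infimum.
  have hmono : StrictMonoOn (tauPlus n k f M) (baseInterval k) := by
    intro R₁ hR₁ R₂ hR₂ hlt
    obtain ⟨-, ⟨p₁, q₁, V₁, hB₁⟩, -⟩ := hex R₁ hR₁
    obtain ⟨-, ⟨p₂, q₂, V₂, hB₂⟩, -⟩ := hex R₂ hR₂
    have hp₁ : p₁ ∈ Ioo R₁ q₁ := ⟨hB₁.1.lt_p, hB₁.1.lt_q⟩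
    have hp₂ : p₂ ∈ Ioo R₂ q₂ := ⟨hB₂.1.lt_p, hB₂.1.lt_q⟩
    have hslope := RightBranch.slope_lt_of_lt (halfWeight_right hn k R₁) hlt hB₁.1 hB₂.1
      (fun r hr => ⟨hB₁.2.1 hr, hr.1⟩) (fun r hr => ⟨hB₂.2.1 hr, hlt.trans hr.1⟩) hf0 hfr
    refine div_lt_div_of_pos_right ?_ hden
    rw [hB₁.rPlus_eq, hB₂.rPlus_eq, hB₁.deriv_eq hp₁, hB₂.deriv_eq hp₂, sq_lt_sq,
      abs_of_neg (hB₁.1.slope_neg _ hp₁), abs_of_neg (hB₂.1.slope_neg _ hp₂)]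
    exact neg_lt_neg hslope
  have hanti : StrictAntiOn (tauMinus n k f M) (openBaseInterval k) := by
    intro R₁ hR₁ R₂ hR₂ hlt
    obtain ⟨-, -, hL₁⟩ := hex R₁ (openBaseInterval_subset k hR₁)
    obtain ⟨-, -, hL₂⟩ := hex R₂ (openBaseInterval_subset k hR₂)
    obtain ⟨p₁, q₁, V₁, hB₁⟩ := hL₁ hR₁.1
    obtain ⟨p₂, q₂, V₂, hB₂⟩ := hL₂ hR₂.1
    have hp₁ : p₁ ∈ Ioo (-R₁) q₁ := ⟨hB₁.1.lt_p, hB₁.1.lt_q⟩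
    have hp₂ : p₂ ∈ Ioo (-R₂) q₂ := ⟨hB₂.1.lt_p, hB₂.1.lt_q⟩
    -- The roles are exchanged because `-R₂ < -R₁`; the weight on `(-R₂, 0)` covers both reflected
    -- branches.
    have hslope := RightBranch.slope_lt_of_lt (halfWeight_left hn hR₂) (neg_lt_neg hlt)
      hB₂.1 hB₁.1 hB₂.2.1 (hB₁.2.1.trans (Ioo_subset_Ioo_left (neg_le_neg hlt.le))) hf0 hfr
    refine div_lt_div_of_pos_right ?_ hden
    rw [hB₁.rMinus_eq hR₁.1, hB₂.rMinus_eq hR₂.1, hB₁.deriv_eq hp₁, hB₂.deriv_eq hp₂, neg_sq,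
      neg_sq, sq_lt_sq, abs_of_neg (hB₁.1.slope_neg _ hp₁), abs_of_neg (hB₂.1.slope_neg _ hp₂)]
    exact neg_lt_neg hslope
  have hzero : tauZero n k f M = tauPlus n k f M 0 := by
    refine IsLeast.csInf_eq ⟨⟨0, h0, rfl⟩, ?_⟩
    rintro _ ⟨R, hR, rfl⟩
    exact hmono.monotoneOn h0 hR hR.1
  exact ⟨hadm, hzero, div_self hden.ne', hanti, hmono.mono (openBaseInterval_subset k)⟩
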